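/- Let $k$ be an algebraically closed field and let $X$ be a projective variety over $k$ (integral, proper over $k$, with an ample line bundle) such that $\operatorname{Pic}(X)$ is free of finite rank $r$ and coincides with the divisor class group, i.e. the canonical homomorphism $\operatorname{Pic}(X)\to\operatorname{Cl}(X)$ is an isomorphism. Let $L_1,\dots,L_r$ be (Cartier divisors of) line bundles whose classes form a basis of $\operatorname{Pic}(X)$, and let $$\operatorname{Cox}(X)=\bigoplus_{(m_1,\dots,m_r)\in\mathbb Z^r}H^0(X,m_1L_1+\dots+m_rL_r),$$ with the multiplication induced by the product of rational functions. This ring is graded by $\operatorname{Pic}(X)$. Assume that $\operatorname{Cox}(X)$ is a finitely generated $k$-algebra. The torus $T_X=\operatorname{Hom}(\operatorname{Pic}(X),k^*)=\operatorname{Spec}k[\operatorname{Pic}(X)]$ acts on $\overline X=\operatorname{Spec}(\operatorname{Cox}(X))$ through the grading: $t\cdot s=t(D)\,s$ for $s\in\operatorname{Cox}(X)_D$. For an ample line bundle $A$ on $X$, let $J_X$ be the radical of the ideal of $\operatorname{Cox}(X)$ generated by $\bigoplus_{n\ge 1}\operatorname{Cox}(X)_{nA}$, and let $\hat X=\operatorname{Spec}(\operatorname{Cox}(X))\setminus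 V(J_X)$. Then the action of $T_X$ on $\overline X$ restricts to an action on $\hat X$, and $X$ is a good geometric quotient of $\hat X$ by $T_X$. That is, there is a morphism $\pi:\hat X\to X$ over $k$ that is $T_X$-invariant, affine and surjective, such that 1. for every open $U\subseteq X$, pullback by $\pi$ identifies $\mathcal O_X(U)$ with the ring of $T_X$-invariant functions on $\pi^{-1}(U)$; 2. $\pi$ maps closed $T_X$-invariant subsets to closed subsets, and disjoint closed $T_X$-invariant subsets to disjoint subsets; 3. the fibres of $\pi$ are the $T_X$-orbits, i.e. the morphism $T_X\times\hat X\to\hat X\times_X\hat X$, $(t,x)\mapsto(t\cdot x,x)$, is surjective. -/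

import Mathlib

open AlgebraicGeometry CategoryTheory TopologicalSpace Opposite
open MonoidalCategory CartesianMonoidalCategory
open scoped DirectSum TensorProduct MonObj

universe u

noncomputable section

namespace CoxQuotient

section CartierDivisors

variable (X : Scheme.{u}) [IsIntegral X]

/-- The image of `𝒪_{X,x}ˣ` in the multiplicative group `K(X)ˣ` of the function field. -/
def stalkUnits (x : X) : Subgroup (X.functionField)ˣ :=
  (Units.map (algebraMap (X.presheaf.stalk x) X.functionField).toMonoidHom).range

/-- The group `K(X)ˣ / 𝒪_{X,x}ˣ`, written additively. -/
def CartierGerm (x : X) : Type u := Additive ((X.functionField)ˣ ⧸ stalkUnits X x)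

instance (x : X) : AddCommGroup (CartierGerm X x) :=
  inferInstanceAs (AddCommGroup (Additive ((X.functionField)ˣ ⧸ stalkUnits X x)))

/-- The class of a nonzero rational function in `K(X)ˣ / 𝒪_{X,x}ˣ`. -/
def toGerm (x : X) : Additive (X.functionField)ˣ →+ CartierGerm X x :=
  MonoidHom.toAdditive (QuotientGroup.mk' (stalkUnits X x))

/-- The global sections of the sheaf `K(X)ˣ / 𝒪_Xˣ`: families of germs that are locally given by
one rational function. -/
def cartierSubgroup : AddSubgroup (∀ x : X, CartierGerm X x) where
  carrier := {D | ∀ x : X, ∃ U : X.Opens, x ∈ U ∧ ∃ g : Additive (X.functionField)ˣ,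
    ∀ y ∈ U, D y = toGerm X y g}
  zero_mem' := fun x => ⟨⊤, trivial, 0, fun y _ => (map_zero (toGerm X y)).symm⟩
  add_mem' := by
    intro D E hD hE x
    obtain ⟨U, hU, g, hg⟩ := hD x
    obtain ⟨V, hV, h, hh⟩ := hE x
    refine ⟨U ⊓ V, ⟨hU, hV⟩, g + h, fun y hy => ?_⟩
    rw [Pi.add_apply, hg y hy.1, hh y hy.2, map_add]
  neg_mem' := by
    intro D hD x
    obtain ⟨U, hU, g, hg⟩ := hD x
    refine ⟨U, hU, -g, fun y hy => ?_⟩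
    rw [Pi.neg_apply, hg y hy, map_neg]

/-- Cartier divisors on an integral scheme. -/
def CartierDivisor : Type u := cartierSubgroup X

instance : AddCommGroup (CartierDivisor X) := inferInstanceAs (AddCommGroup (cartierSubgroup X))

variable {X}

/-- The germ of a Cartier divisor at a point. -/
def germ (x : X) : CartierDivisor X →+ CartierGerm X x :=
  (Pi.evalAddMonoidHom _ x).comp (cartierSubgroup X).subtype

/-- `g` is a local equation of the Cartier divisor `D` at the point `x`. -/
def IsLocalEquation (D : CartierDivisor X) (x : X) (g : (X.functionField)ˣ) : Prop :=
  germ x D = toGerm X x (Additive.ofMul g)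

lemma exists_isLocalEquation_nhds (D : CartierDivisor X) (x : X) :
    ∃ U : X.Opens, x ∈ U ∧ ∃ g, ∀ y ∈ U, IsLocalEquation D y g := by
  obtain ⟨U, hU, g, hg⟩ := D.2 x
  exact ⟨U, hU, g.toMul, hg⟩

lemma exists_isLocalEquation (D : CartierDivisor X) (x : X) : ∃ g, IsLocalEquation D x g := by
  obtain ⟨U, hU, g, hg⟩ := exists_isLocalEquation_nhds D x
  exact ⟨g, hg x hU⟩

lemma IsLocalEquation.add {D E : CartierDivisor X} {x : X} {g h : (X.functionField)ˣ}
    (hg : IsLocalEquation D x g) (hh : IsLocalEquation E x h) :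
    IsLocalEquation (D + E) x (g * h) := by
  unfold IsLocalEquation at *
  rw [map_add, hg, hh, ofMul_mul, map_add]

lemma isLocalEquation_zero_one (x : X) : IsLocalEquation (0 : CartierDivisor X) x 1 := by
  unfold IsLocalEquation
  rw [map_zero, ofMul_one, map_zero]

lemma IsLocalEquation.exists_eq {D : CartierDivisor X} {x : X} {g h : (X.functionField)ˣ}
    (hg : IsLocalEquation D x g) (hh : IsLocalEquation D x h) :
    ∃ v : (X.presheaf.stalk x)ˣ,
      (h : X.functionField) = g * algebraMap (X.presheaf.stalk x) X.functionField v := by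
  have h1 : (QuotientGroup.mk g : (X.functionField)ˣ ⧸ stalkUnits X x) = QuotientGroup.mk h :=
    Additive.ofMul.injective (hg.symm.trans hh)
  obtain ⟨v, hv⟩ := QuotientGroup.eq.mp h1
  refine ⟨v, ?_⟩
  have h2 : h = g * (g⁻¹ * h) := by group
  rw [h2, ← hv]
  rfl

variable (X) in
/-- The principal Cartier divisor `div(g)` of a nonzero rational function `g`. -/
def principalDivisor : Additive (X.functionField)ˣ →+ CartierDivisor X :=
  (AddMonoidHom.pi (toGerm X)).codRestrict (cartierSubgroup X)
    fun g _ => ⟨⊤, trivial, g, fun _ _ => rfl⟩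

variable (X) in
/-- The Picard group of an integral scheme: Cartier divisors modulo linear equivalence.
The class of `D` is the class of the line bundle `𝒪_X(D)`. -/
def Pic : Type u := CartierDivisor X ⧸ (principalDivisor X).range

instance : AddCommGroup (Pic X) :=
  inferInstanceAs (AddCommGroup (CartierDivisor X ⧸ (principalDivisor X).range))

/-- The class of a Cartier divisor in the Picard group. -/
def toPic : CartierDivisor X →+ Pic X := QuotientAddGroup.mk' (principalDivisor X).range

end CartierDivisors

section WeilDivisors

variable (X : Scheme.{u}) [IsIntegral X] [IsLocallyNoetherian X]

/-- Locally finite integral combinations of points of codimension one. -/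
def weilSubgroup : AddSubgroup (AlgebraicCycle X ℤ) where
  carrier := {W | ∀ x : X, W x ≠ 0 → Order.coheight x = 1}
  zero_mem' := fun x hx => (hx rfl).elim
  add_mem' := by
    intro V W hV hW x hx
    by_cases h : V x = 0
    · refine hW x fun h' => hx ?_
      change V x + W x = 0
      rw [h, h', add_zero]
    · exact hV x h
  neg_mem' := by
    intro V hV x hx
    refine hV x fun h => hx ?_
    change - V x = 0
    rw [h, neg_zero]

/-- Weil divisors. -/
def WeilDivisor : Type u := weilSubgroup X

instance : AddCommGroup (WeilDivisor X) := inferInstanceAs (AddCommGroup (weilSubgroup X))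

/-- The order along (the closure of) `z` as a homomorphism on `K(X)ˣ`. -/
def ordUnits (z : X) : (X.functionField)ˣ →* Multiplicative ℤ where
  toFun g := Multiplicative.ofAdd (Scheme.ord (g : X.functionField) z)
  map_one' := by
    have h := Scheme.ord_mul (x := z) (one_ne_zero (α := X.functionField))
      (one_ne_zero (α := X.functionField))
    rw [mul_one] at h
    rw [Units.val_one, ← ofAdd_zero]
    congr 1
    omega
  map_mul' g h := by
    rw [Units.val_mul, Scheme.ord_mul g.ne_zero h.ne_zero, ofAdd_add]

lemma stalkUnits_le_ker_ordUnits (z : X) : stalkUnits X z ≤ (ordUnits X z).ker := by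
  rintro _ ⟨v, rfl⟩
  rw [MonoidHom.mem_ker]
  change Multiplicative.ofAdd (Scheme.ord (algebraMap (X.presheaf.stalk z) X.functionField v) z) =
    1
  rw [← ofAdd_zero]
  congr 1
  by_cases hz : Order.coheight z = 1
  · rw [Scheme.ord_eq_iff hz
      ((IsUnit.map (algebraMap (X.presheaf.stalk z) X.functionField) v.isUnit).ne_zero)]
    have : Ring.KrullDimLE 1 (X.presheaf.stalk z) := krullDimLE_of_coheight_le hz.le
    exact Ring.ordFrac_of_isUnit v.isUnit
  · exact Scheme.ord_eq_zero_of_coheight_neq_one hz _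

/-- The order along `z` of a germ of Cartier divisor at `z`, i.e. of any of its local equations. -/
def ordGerm (z : X) : CartierGerm X z →+ ℤ :=
  MonoidHom.toAdditiveLeft (QuotientGroup.lift _ (ordUnits X z) (stalkUnits_le_ker_ordUnits X z))

lemma ordGerm_toGerm (z : X) (g : Additive (X.functionField)ˣ) :
    ordGerm X z (toGerm X z g) = Scheme.ord (g.toMul : X.functionField) z := rfl

lemma ordGerm_of_coheight_ne_one {z : X} (hz : Order.coheight z ≠ 1) (c : CartierGerm X z) :
    ordGerm X z c = 0 := by
  obtain ⟨g, rfl⟩ : ∃ g, toGerm X z g = c := by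
    obtain ⟨g, hg⟩ := QuotientGroup.mk_surjective (Additive.toMul c)
    exact ⟨Additive.ofMul g, congrArg Additive.ofMul hg⟩
  rw [ordGerm_toGerm, Scheme.ord_eq_zero_of_coheight_neq_one hz]

/-- A nonzero rational function has nonzero order at only finitely many points of any affine
open set. -/
lemma ord_locallyFinite (g : (X.functionField)ˣ) (x : X) :
    ∃ t ∈ nhds x, (t ∩ Function.support (Scheme.ord (g : X.functionField))).Finite := by
  obtain ⟨V, hV, f, hne, hf, hu⟩ := exists_isUnit_germ_eq X (g : X.functionField) g.ne_zero
  obtain ⟨_, ⟨A, hA, rfl⟩, hxA, -⟩ :=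
    X.isBasis_affineOpens.exists_subset_of_mem_open (Set.mem_univ x) isOpen_univ
  refine ⟨A, A.isOpen.mem_nhds hxA, ?_⟩
  have hA' : IsNoetherianRing Γ(X, A) := IsLocallyNoetherian.component_noetherian ⟨A, hA⟩
  have hN : NoetherianSpace (A : Set X) := noetherianSpace_of_isAffineOpen A hA
  have hη : genericPoint X ∈ V :=
    ((genericPoint_spec X).mem_open_set_iff V.isOpen).mpr (by simpa using hne)
  obtain ⟨S, hSfin, hScl, hSirr, hZ⟩ :=
    NoetherianSpace.exists_finite_set_isClosed_irreducible
      (s := (Subtype.val ⁻¹' (V : Set X) : Set (A : Set X))ᶜ)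
      (V.isOpen.preimage continuous_subtype_val).isClosed_compl
  have hSZ : ∀ C ∈ S, C ⊆ (Subtype.val ⁻¹' (V : Set X) : Set (A : Set X))ᶜ := fun C hC => by
    rw [hZ]
    exact Set.subset_sUnion_of_mem hC
  have hq : QuasiSober (A : Set X) := A.isOpen.isOpenEmbedding_subtypeVal.quasiSober
  have hgen : ∀ C : S, ∃ c : (A : Set X), IsGenericPoint c C.1 := fun C =>
    QuasiSober.sober (hSirr C.1 C.2) (hScl C.1 C.2)
  choose c hc using hgen
  have : Finite S := hSfin
  refine (Set.finite_range fun C : S => (c C : X)).subset ?_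
  rintro z ⟨hzA, hz⟩
  have hzV : z ∉ V := fun hzV => hz (by
    rw [← hf]
    exact Scheme.ord_of_isUnit hu hzV)
  have hz1 : Order.coheight z = 1 := by
    by_contra h
    exact hz (Scheme.ord_eq_zero_of_coheight_neq_one h _)
  have hzZ : (⟨z, hzA⟩ : (A : Set X)) ∈ (Subtype.val ⁻¹' (V : Set X) : Set (A : Set X))ᶜ := hzV
  rw [hZ] at hzZ
  obtain ⟨C, hCS, hzC⟩ := hzZ
  refine ⟨⟨C, hCS⟩, ?_⟩
  have hcZ : (c ⟨C, hCS⟩ : X) ∉ V := hSZ C hCS (hc ⟨C, hCS⟩).mem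
  have hspec : (c ⟨C, hCS⟩ : X) ⤳ z :=
    ((hc ⟨C, hCS⟩).specializes hzC).map continuous_subtype_val
  by_contra hne'
  have hlt : z < (c ⟨C, hCS⟩ : X) := by
    refine lt_of_le_not_ge hspec fun h => hne' ?_
    exact (Specializes.antisymm hspec h).eq
  have hlt' : (c ⟨C, hCS⟩ : X) < genericPoint X := by
    refine lt_of_le_not_ge (genericPoint_specializes _) fun h => hcZ ?_
    exact Specializes.mem_open h V.isOpen hη
  have h1 := Order.coheight_add_one_le hlt
  have h2 := Order.coheight_add_one_le hlt'
  rw [hz1] at h1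
  have h3 : (1 : ℕ∞) + 1 ≤ 1 :=
    (add_le_add_left (le_trans le_add_self h2) 1).trans h1
  exact absurd h3 (by decide)

/-- The Weil divisor of a Cartier divisor. -/
def cartierToWeil : CartierDivisor X →+ WeilDivisor X where
  toFun D := ⟨⟨fun z => ordGerm X z (germ z D), Set.subset_univ _, fun x _ => by
      obtain ⟨U, hU, g, hg⟩ := exists_isLocalEquation_nhds D x
      obtain ⟨t, ht, hfin⟩ := ord_locallyFinite X g x
      refine ⟨U ∩ t, Filter.inter_mem (U.isOpen.mem_nhds hU) ht, hfin.subset ?_⟩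
      rintro y ⟨⟨hyU, hyt⟩, hy⟩
      refine ⟨hyt, ?_⟩
      rw [Function.mem_support] at hy ⊢
      rwa [hg y hyU, ordGerm_toGerm] at hy⟩,
    fun z hz => by
      by_contra h
      exact hz (ordGerm_of_coheight_ne_one X h _)⟩
  map_zero' := Subtype.ext <| Function.locallyFinsuppWithin.ext fun z => by
    change ordGerm X z (germ z 0) = 0
    rw [map_zero, map_zero]
  map_add' D E := Subtype.ext <| Function.locallyFinsuppWithin.ext fun z => by
    change ordGerm X z (germ z (D + E)) = ordGerm X z (germ z D) + ordGerm X z (germ z E)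
    rw [map_add, map_add]

/-- The divisor class group: Weil divisors modulo divisors of rational functions. -/
def ClassGroup : Type u :=
  WeilDivisor X ⧸ ((cartierToWeil X).comp (principalDivisor X)).range

instance : AddCommGroup (ClassGroup X) :=
  inferInstanceAs (AddCommGroup (WeilDivisor X ⧸ ((cartierToWeil X).comp (principalDivisor X)).range))

/-- The canonical homomorphism `Pic(X) → Cl(X)`. -/
def picToClassGroup : Pic X →+ ClassGroup X :=
  QuotientAddGroup.map _ _ (cartierToWeil X) (by
    rintro _ ⟨g, rfl⟩
    exact ⟨g, rfl⟩)

/-- A scheme locally of finite type over a field is locally Noetherian. -/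
lemma isLocallyNoetherian_of_locallyOfFiniteType (k : Type u) [Field k] (X : Scheme.{u})
    [X.Over (Spec (.of k))] [LocallyOfFiniteType (X ↘ Spec (.of k))] : IsLocallyNoetherian X :=
  LocallyOfFiniteType.isLocallyNoetherian (X ↘ Spec (.of k))

/-- `Pic(X)` coincides with `Cl(X)`: the canonical homomorphism `Pic(X) → Cl(X)` is bijective. -/
def PicEqCl (k : Type u) [Field k] (X : Scheme.{u}) [IsIntegral X] [X.Over (Spec (.of k))]
    [LocallyOfFiniteType (X ↘ Spec (.of k))] : Prop :=
  haveI := isLocallyNoetherian_of_locallyOfFiniteType k X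
  Function.Bijective (picToClassGroup X)

end WeilDivisors

section CoxRing

variable (k : Type u) [Field k] (X : Scheme.{u}) [IsIntegral X] [X.Over (Spec (.of k))]

/-- The constants `k → Γ(X, 𝒪_X)` of a scheme over `k`. -/
def constants : k →+* Γ(X, ⊤) :=
  ((Scheme.ΓSpecIso (.of k)).inv ≫ (X ↘ Spec (.of k)).appTop).hom

/-- The function field of an integral `k`-scheme is a `k`-algebra. -/
instance functionFieldAlgebra : Algebra k X.functionField :=
  ((X.presheaf.germ ⊤ (genericPoint X) (Opens.mem_top _)).hom.comp (constants k X)).toAlgebra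

variable {X}

/-- `H⁰(X, D) = H⁰(X, 𝒪_X(D))`: the rational functions `f` with `div(f) + D ≥ 0`, i.e. such that
`f * g` is regular at `x` for each local equation `g` of `D` at each point `x`. -/
def H0 (D : CartierDivisor X) : Submodule k X.functionField where
  carrier := {f | ∀ (x : X) (g : (X.functionField)ˣ), IsLocalEquation D x g →
    ∃ a : X.presheaf.stalk x, algebraMap (X.presheaf.stalk x) X.functionField a = f * g}
  zero_mem' := fun x g _ => ⟨0, by rw [map_zero, zero_mul]⟩
  add_mem' := by
    intro f f' hf hf' x g hg
    obtain ⟨a, ha⟩ := hf x g hg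
    obtain ⟨a', ha'⟩ := hf' x g hg
    exact ⟨a + a', by rw [map_add, ha, ha', add_mul]⟩
  smul_mem' := by
    intro c f hf x g hg
    obtain ⟨a, ha⟩ := hf x g hg
    have : Nonempty (⊤ : X.Opens) := ⟨⟨x, Opens.mem_top x⟩⟩
    refine ⟨X.presheaf.germ ⊤ x (Opens.mem_top x) (constants k X c) * a, ?_⟩
    rw [map_mul, ha, Scheme.algebraMap_germ_eq_germToFunctionField, Algebra.smul_def, mul_assoc]
    rfl

lemma one_mem_H0 : (1 : X.functionField) ∈ H0 k (0 : CartierDivisor X) := by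
  intro x g hg
  obtain ⟨v, hv⟩ := (isLocalEquation_zero_one x).exists_eq hg
  exact ⟨v, by rw [hv, Units.val_one, one_mul, one_mul]⟩

lemma mul_mem_H0 {D E : CartierDivisor X} {f f' : X.functionField} (hf : f ∈ H0 k D)
    (hf' : f' ∈ H0 k E) : f * f' ∈ H0 k (D + E) := by
  intro x g hg
  obtain ⟨d, hd⟩ := exists_isLocalEquation D x
  obtain ⟨e, he⟩ := exists_isLocalEquation E x
  obtain ⟨v, hv⟩ := (hd.add he).exists_eq hg
  obtain ⟨a, ha⟩ := hf x d hd
  obtain ⟨b, hb⟩ := hf' x e he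
  refine ⟨a * b * v, ?_⟩
  rw [map_mul, map_mul, ha, hb, hv, Units.val_mul]
  ring

/-- The section `f` of `𝒪_X(D)` does not vanish at `x`: it generates `𝒪_X(D)` near `x`, i.e.
`div(f) + D = 0` near `x`. -/
def IsNonvanishingAt (D : CartierDivisor X) (f : X.functionField) (x : X) : Prop :=
  ∃ h : f ≠ 0, IsLocalEquation D x (Units.mk0 f h)⁻¹

/-- `D` is ample: `X` is quasi-compact and each point has an affine neighbourhood of the form
`X_s` for a section `s` of a positive multiple of `D`. -/
structure IsAmple (D : CartierDivisor X) : Prop where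
  compact : CompactSpace X
  exists_section : ∀ x : X, ∃ n : ℕ, 0 < n ∧ ∃ s ∈ H0 k (n • D), ∃ U : X.Opens,
    IsAffineOpen U ∧ x ∈ U ∧ ∀ y : X, y ∈ U ↔ IsNonvanishingAt (n • D) s y

variable {r : ℕ} (L : Fin r → CartierDivisor X)

/-- The divisor `m₁L₁ + ⋯ + m_rL_r`. -/
def multiDivisor : (Fin r → ℤ) →+ CartierDivisor X where
  toFun m := ∑ i, m i • L i
  map_zero' := by simp
  map_add' m n := by simp [add_smul, Finset.sum_add_distrib]

/-- The graded piece `H⁰(X, m₁L₁ + ⋯ + m_rL_r)`. -/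
abbrev coxPiece (m : Fin r → ℤ) : Submodule k X.functionField := H0 k (multiDivisor L m)

instance : SetLike.GradedMonoid (coxPiece k L) where
  one_mem := by
    unfold coxPiece
    rw [map_zero]
    exact one_mem_H0 k
  mul_mem m n f f' hf hf' := by
    unfold coxPiece at *
    rw [map_add]
    exact mul_mem_H0 k hf hf'

/-- The Cox ring `Cox(X, L) = ⨁ₘ H⁰(X, m₁L₁ + ⋯ + m_rL_r)`, with the multiplication induced by the
product of rational functions. -/
def Cox : Type u := ⨁ m : Fin r → ℤ, coxPiece k L m

instance : CommRing (Cox k L) := inferInstanceAs (CommRing (⨁ m : Fin r → ℤ, coxPiece k L m))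

instance : Algebra k (Cox k L) := inferInstanceAs (Algebra k (⨁ m : Fin r → ℤ, coxPiece k L m))

/-- The homogeneous element of degree `m` of the Cox ring given by a section. -/
def coxOf (m : Fin r → ℤ) : coxPiece k L m →ₗ[k] Cox k L :=
  DirectSum.lof k (Fin r → ℤ) (fun m => coxPiece k L m) m

lemma cox_induction {P : Cox k L → Prop} (c : Cox k L) (zero : P 0)
    (of : ∀ m s, P (coxOf k L m s)) (add : ∀ x y, P x → P y → P (x + y)) : P c :=
  DirectSum.induction_on (motive := P) c zero of add

/-- The ideal `B_{X,D}` generated by the homogeneous elements whose degree in `Pic(X)` is a positive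
multiple of the class of `D`, i.e. by the positive part of `R_D = ⨁_{n ≥ 0} Cox(X)_{nD}`. -/
def sectionIdeal (D : CartierDivisor X) : Ideal (Cox k L) :=
  Ideal.span {z | ∃ n : ℕ, 0 < n ∧ ∃ m : Fin r → ℤ,
    toPic (multiDivisor L m) = n • toPic D ∧ ∃ s : coxPiece k L m, z = coxOf k L m s}

/-- The ideal `J_{X,D}`, the radical of `B_{X,D}`. For ample `D` this is the irrelevant ideal. -/
def irrelevantIdeal (D : CartierDivisor X) : Ideal (Cox k L) := (sectionIdeal k L D).radical

/-- The total coordinate space `X̄ = Spec(Cox(X))`. -/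
abbrev totalSpace : Scheme.{u} := Spec (.of (Cox k L))

/-- The open subset `X̂ = Spec(Cox(X)) \ V(J_{X,D})`. -/
def semistable (D : CartierDivisor X) : (totalSpace k L).Opens :=
  ⟨(PrimeSpectrum.zeroLocus (irrelevantIdeal k L D : Set (Cox k L)))ᶜ,
    (PrimeSpectrum.isClosed_zeroLocus _).isOpen_compl⟩

end CoxRing

section SpecAction

open Functor.LaxMonoidal (μ_natural_left_assoc μ_natural_right_assoc)
open scoped Obj MonoidalLeftAction

/-- A lax monoidal functor maps an action of a monoid object to an action of its image. -/
abbrev modObjObj {C D : Type*} [Category C] [Category D] [MonoidalCategory C] [MonoidalCategory D]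
    (F : C ⥤ D) [F.LaxMonoidal] (M X : C) [MonObj M] [ModObj M X] :
    ModObj (F.obj M) (F.obj X) where
  smul := Functor.LaxMonoidal.μ F M X ≫ F.map γ[M, X]
  one_smul := by
    change (Functor.LaxMonoidal.ε F ≫ F.map η[M]) ▷ F.obj X ≫ _ = (λ_ _).hom
    simp_rw [comp_whiskerRight, Category.assoc, μ_natural_left_assoc]
    rw [← F.map_comp, ModObj.one_smul_self]
    simp
  mul_smul := by
    change (Functor.LaxMonoidal.μ F M M ≫ F.map μ[M]) ▷ F.obj X ≫ _ =
      (α_ _ _ _).hom ≫ F.obj M ◁ _ ≫ _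
    simp_rw [comp_whiskerRight, Category.assoc, μ_natural_left_assoc,
      MonoidalCategory.whiskerLeft_comp, Category.assoc, μ_natural_right_assoc]
    slice_lhs 3 4 => rw [← F.map_comp, ModObj.mul_smul_self]
    simp

variable (R A C : CommRingCat.{u}) [Bialgebra R A] [Algebra R C] (ρ : C →ₐ[R] A ⊗[R] C)
  (h1 : ∀ c, Algebra.TensorProduct.lid R C
    (Algebra.TensorProduct.map (Bialgebra.counitAlgHom R A) (AlgHom.id R C) (ρ c)) = c)
  (h2 : ∀ c, Algebra.TensorProduct.assoc R R R A A C
      (Algebra.TensorProduct.map (Bialgebra.comulAlgHom R A) (AlgHom.id R C) (ρ c)) =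
    Algebra.TensorProduct.map (AlgHom.id R A) ρ (ρ c))

/-- A counital and coassociative coaction of a bialgebra on an algebra, as an action in the opposite
category of commutative algebras. -/
@[reducible]
def coactObj :
    ModObj (C := (CommAlgCat R)ᵒᵖ) (op (CommAlgCat.of R A)) (op (CommAlgCat.of R C)) where
  smul := (CommAlgCat.ofHom ρ).op
  one_smul := by
    apply Quiver.Hom.unop_inj
    ext c
    exact (Algebra.TensorProduct.lid R C).injective ((h1 c).trans
      ((Algebra.TensorProduct.lid R C).apply_symm_apply c).symm)
  mul_smul := by
    apply Quiver.Hom.unop_inj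
    ext c
    exact (Algebra.TensorProduct.assoc R R R A A C).injective ((h2 c).trans
      ((Algebra.TensorProduct.assoc R R R A A C).apply_symm_apply _).symm)

/-- The action of `Spec A` on `Spec C` over `Spec R` given by a coaction `ρ : C → A ⊗ C`. -/
@[reducible]
def modSpec : ModObj ((Spec A).asOver (Spec R)) ((Spec C).asOver (Spec R)) :=
  letI := coactObj R A C ρ h1 h2
  modObjObj (algSpec R) (op (CommAlgCat.of R A)) (op (CommAlgCat.of R C))

lemma modSpec_left : (modSpec R A C ρ h1 h2).smul.left =
    (pullbackSpecIso R A C).hom ≫ Spec.map (CommRingCat.ofHom ρ.toRingHom) := rfl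

end SpecAction

section Torus

variable (k : Type u) [Field k] (X : Scheme.{u}) [IsIntegral X]

/-- The torus `T_X = Hom(Pic(X), k*)`, the diagonalizable group scheme with character group
`Pic(X)`: the spectrum of the group algebra `k[Pic(X)]`. -/
abbrev torus : Over (Spec (.of k)) :=
  (Spec (.of (AddMonoidAlgebra k (Pic X)))).asOver (Spec (.of k))

variable {X} [X.Over (Spec (.of k))] {r : ℕ} (L : Fin r → CartierDivisor X)

/-- The coaction on the graded piece of degree `m`. -/
def coactionPiece (m : Fin r → ℤ) :
    coxPiece k L m →ₗ[k] AddMonoidAlgebra k (Pic X) ⊗[k] Cox k L :=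
  (TensorProduct.mk k _ _ (AddMonoidAlgebra.single (toPic (multiDivisor L m)) 1)).comp
    (coxOf k L m)

/-- The coaction `Cox(X) → k[Pic(X)] ⊗ Cox(X)`, which maps `s` of degree `D` to `χ^D ⊗ s`, where
`χ^D` is the character of `T_X` given by the class of `D`. -/
def coaction : Cox k L →ₐ[k] AddMonoidAlgebra k (Pic X) ⊗[k] Cox k L :=
  DirectSum.toAlgebra k (fun m => coxPiece k L m) (coactionPiece k L)
    (by
      change AddMonoidAlgebra.single (toPic (multiDivisor L 0)) (1 : k) ⊗ₜ[k] (1 : Cox k L) = 1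
      rw [map_zero, map_zero, ← AddMonoidAlgebra.one_def, Algebra.TensorProduct.one_def])
    (by
      intro m n a b
      change AddMonoidAlgebra.single (toPic (multiDivisor L (m + n))) (1 : k) ⊗ₜ[k]
          (DirectSum.of (fun m => coxPiece k L m) (m + n)
            (GradedMonoid.GMul.mul (A := fun m => coxPiece k L m) a b) : Cox k L) =
        (AddMonoidAlgebra.single (toPic (multiDivisor L m)) (1 : k) ⊗ₜ[k] coxOf k L m a) *
          (AddMonoidAlgebra.single (toPic (multiDivisor L n)) (1 : k) ⊗ₜ[k] coxOf k L n b)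
      rw [Algebra.TensorProduct.tmul_mul_tmul, AddMonoidAlgebra.single_mul_single, mul_one,
        ← map_add, ← map_add, ← DirectSum.of_mul_of]
      rfl)

lemma coaction_coxOf (m : Fin r → ℤ) (s : coxPiece k L m) :
    coaction k L (coxOf k L m s) =
      AddMonoidAlgebra.single (toPic (multiDivisor L m)) 1 ⊗ₜ coxOf k L m s :=
  DirectSum.toAddMonoid_of (fun m => (coactionPiece k L m).toAddMonoidHom) m s

lemma coaction_counit (c : Cox k L) : Algebra.TensorProduct.lid k (Cox k L)
    (Algebra.TensorProduct.map (Bialgebra.counitAlgHom k (AddMonoidAlgebra k (Pic X)))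
      (AlgHom.id k (Cox k L)) (coaction k L c)) = c := by
  induction c using cox_induction with
  | zero => simp only [map_zero]
  | of m s =>
    rw [coaction_coxOf, Algebra.TensorProduct.map_tmul]
    simp
  | add x y hx hy =>
    rw [map_add, map_add, map_add, hx, hy]

lemma coaction_coassoc (c : Cox k L) :
    Algebra.TensorProduct.assoc k k k (AddMonoidAlgebra k (Pic X)) (AddMonoidAlgebra k (Pic X))
      (Cox k L) (Algebra.TensorProduct.map (Bialgebra.comulAlgHom k (AddMonoidAlgebra k (Pic X)))
        (AlgHom.id k (Cox k L)) (coaction k L c)) =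
    Algebra.TensorProduct.map (AlgHom.id k (AddMonoidAlgebra k (Pic X))) (coaction k L)
      (coaction k L c) := by
  induction c using cox_induction with
  | zero => simp only [map_zero]
  | of m s =>
    rw [coaction_coxOf, Algebra.TensorProduct.map_tmul, Algebra.TensorProduct.map_tmul,
      coaction_coxOf]
    simp
  | add x y hx hy =>
    rw [map_add, map_add, map_add, hx, hy, map_add]

/-- `X̄` as a scheme over `k`. -/
abbrev totalSpaceOver : Over (Spec (.of k)) := (totalSpace k L).asOver (Spec (.of k))

/-- The action of the torus `T_X` on `X̄`. -/
instance torusAction : ModObj (torus k X) (totalSpaceOver k L) :=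
  modSpec (.of k) (.of (AddMonoidAlgebra k (Pic X))) (.of (Cox k L)) (coaction k L)
    (coaction_counit k L) (coaction_coassoc k L)

/-- `X̂` as a scheme over `k`. -/
abbrev semistableOver (D : CartierDivisor X) : Over (Spec (.of k)) :=
  Over.mk ((semistable k L D).ι ≫ totalSpace k L ↘ Spec (.of k))

/-- The inclusion `X̂ → X̄`. -/
abbrev semistableInclusion (D : CartierDivisor X) : semistableOver k L D ⟶ totalSpaceOver k L :=
  Over.homMk (semistable k L D).ι

end Torus

section Quotients

variable {S : Scheme.{u}} (G : Over S) [MonObj G] {Y X : Over S} [ModObj G Y]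

/-- A subset of `Y` is invariant if its preimages under the action and under the projection
`G × Y → Y` coincide. -/
def IsInvariantSet (Z : Set Y.left) : Prop :=
  (γ[G, Y]).left ⁻¹' Z = (snd G Y).left ⁻¹' Z

/-- A function on an open subset of `Y` is invariant if its pullbacks under the action and under the
projection `G × Y → Y` coincide. -/
def IsInvariantSection {U : Y.left.Opens} (f : Γ(Y.left, U)) : Prop :=
  ∀ (W : (G ⊗ Y).left.Opens) (h₁ : W ≤ (γ[G, Y]).left ⁻¹ᵁ U) (h₂ : W ≤ (snd G Y).left ⁻¹ᵁ U),
    (γ[G, Y]).left.appLE U W h₁ f = (snd G Y).left.appLE U W h₂ f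

/-- `π : Y → X` is a good quotient of `Y` by the action of the group scheme `G`: it is invariant,
affine and surjective, the functions on an open subset `U` of `X` are the invariant functions on
`π⁻¹(U)`, and `π` maps closed invariant sets to closed sets, and disjoint ones to disjoint ones. -/
structure IsGoodQuotient (π : Y ⟶ X) : Prop where
  invariant : γ[G, Y] ≫ π = snd G Y ≫ π
  affine : IsAffineHom π.left
  surjective : Function.Surjective π.left
  injective_app : ∀ U : X.left.Opens, Function.Injective (π.left.app U)
  range_app : ∀ (U : X.left.Opens) (f : Γ(Y.left, π.left ⁻¹ᵁ U)),
    (∃ g, π.left.app U g = f) ↔ IsInvariantSection G f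
  isClosed_image : ∀ Z : Set Y.left, IsClosed Z → IsInvariantSet G Z → IsClosed (π.left '' Z)
  disjoint_image : ∀ Z Z' : Set Y.left, IsClosed Z → IsInvariantSet G Z → IsClosed Z' →
    IsInvariantSet G Z' → Disjoint Z Z' → Disjoint (π.left '' Z) (π.left '' Z')

/-- A good quotient `π : Y → X` is a good geometric quotient if its fibres are the orbits of `G`:
the morphism `(g, y) ↦ (g • y, y)` from `G × Y` to `Y ×_X Y` is surjective. -/
structure IsGoodGeometricQuotient (π : Y ⟶ X) : Prop extends IsGoodQuotient G π where
  orbits : Function.Surjective (Limits.pullback.lift (f := π.left) (g := π.left)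
    (γ[G, Y]).left (snd G Y).left (congrArg (fun φ => φ.left) invariant))

end Quotients

end CoxQuotient

end

/-!
For a section `s` of a positive multiple of `A` whose nonvanishing locus `X_s` is affine and over
which all the `Lᵢ` are trivial, the open subset `D(s)` of `X̄` is a trivial `T_X`-torsor over `X_s`.
Indeed the elements of degree zero of `Cox(X)_s` are the functions on `X_s`, and local equations
`gᵢ` of the `Lᵢ` on `X_s` provide units of every degree. Evaluating homogeneous elements at the `gᵢ`
gives a section `X_s → D(s)`, and the units are the coordinates relative to this section. The
projections `D(s) → X_s` agree on overlaps because `D(s) ∩ D(s') = D(ss')`.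

The sets `D(s)` cover `X̂`. At a prime `P` of `Cox(X)` that does not contain the irrelevant ideal,
choose a valuation ring of the field of Laurent fractions over `k(X)` that dominates `Cox(X)_P`. By
the valuative criterion it has a center on `X`; the center lies in some `X_s` as above, and then `s`
is not in `P`. Hence `X̂ → X` is a Zariski locally trivial torsor, and the properties of a good
geometric quotient are local on `X`.
-/

noncomputable section

namespace CoxQuotient

section OpenImmersions

variable {S : Scheme.{u}} {Z U Y : Over S} (i : U ⟶ Y)

variable [IsOpenImmersion i.left] (f : Z ⟶ Y) (h : Set.range f.left ⊆ Set.range i.left)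

/-- The factorization of a morphism over `S` through an open immersion containing its range. -/
def overLift : Z ⟶ U :=
  Over.homMk (IsOpenImmersion.lift i.left f.left h) (by
    rw [← Over.w i, IsOpenImmersion.lift_fac_assoc, Over.w f])

lemma overLift_comp : overLift i f h ≫ i = f :=
  Over.OverMorphism.ext (IsOpenImmersion.lift_fac _ _ _)

end OpenImmersions

/-! ### Zariski locally trivial torsors -/

section LocalTrivialization

open Limits

lemma appLE_congr_hom {Y Z : Scheme.{u}} {f g : Y ⟶ Z} (h : f = g) {U : Z.Opens} {V : Y.Opens}
    (e : V ≤ f ⁻¹ᵁ U) : f.appLE U V e = g.appLE U V (h ▸ e) := by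
  subst h
  rfl

lemma app_comp_appLE_of_comm {T Y Y' Z : Scheme.{u}} {f : T ⟶ Y} {g : Y ⟶ Z} {f' : T ⟶ Y'}
    {g' : Y' ⟶ Z} (h : f ≫ g = f' ≫ g') {U : Z.Opens} {V : T.Opens}
    (e : V ≤ f ⁻¹ᵁ g ⁻¹ᵁ U) (e' : V ≤ f' ⁻¹ᵁ g' ⁻¹ᵁ U) :
    g.app U ≫ f.appLE _ V e = g'.app U ≫ f'.appLE _ V e' :=
  calc g.app U ≫ f.appLE _ V e = (f ≫ g).appLE U V e := (Scheme.Hom.comp_appLE f g U V e).symm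
    _ = (f' ≫ g').appLE U V e' := appLE_congr_hom h e
    _ = g'.app U ≫ f'.appLE _ V e' := Scheme.Hom.comp_appLE f' g' U V e'

variable {S : Scheme.{u}} (G : Over S) [MonObj G] {Y X : Over S} [ModObj G Y]

/-- A trivialization of `π : Y ⟶ X` as a `G`-torsor over an open subscheme `base` of `X`, whose
preimage is the open subscheme `total` of `Y`. The isomorphism `total ≅ G × base` is recorded by a
section `sec` of `proj : total ⟶ base` and by the maps `coord` and `coordInv` to `G` with
`y = coord y • sec (proj y)` and `sec (proj y) = coordInv y • y`; no inverse on `G` is needed. -/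
structure LocalTrivialization (π : Y ⟶ X) where
  base : Over S
  total : Over S
  baseHom : base ⟶ X
  totalHom : total ⟶ Y
  proj : total ⟶ base
  sec : base ⟶ total
  coord : total ⟶ G
  coordInv : total ⟶ G
  isOpenImmersion_baseHom : IsOpenImmersion baseHom.left
  isOpenImmersion_totalHom : IsOpenImmersion totalHom.left
  range_totalHom : Set.range totalHom.left = π.left ⁻¹' Set.range baseHom.left
  proj_baseHom : proj ≫ baseHom = totalHom ≫ π
  sec_proj : sec ≫ proj = 𝟙 base
  coord_smul : lift coord (proj ≫ sec ≫ totalHom) ≫ γ[G,Y] = totalHom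
  coordInv_smul : lift coordInv totalHom ≫ γ[G,Y] = proj ≫ sec ≫ totalHom

attribute [instance] LocalTrivialization.isOpenImmersion_baseHom
  LocalTrivialization.isOpenImmersion_totalHom

/-- `π : Y ⟶ X` is a `G`-torsor that is trivial locally on `X` for the Zariski topology. -/
structure IsLocallyTrivialTorsor (π : Y ⟶ X) : Prop where
  invariant : γ[G,Y] ≫ π = snd G Y ≫ π
  exists_trivialization : ∀ x : X.left,
    ∃ t : LocalTrivialization G π, x ∈ Set.range t.baseHom.left

variable {G}

lemma IsInvariantSection.appLE_eq {U : Y.left.Opens} {f : Γ(Y.left, U)}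
    (hf : IsInvariantSection G f) {T : Over S} {y y' : T ⟶ Y} (ψ : T ⟶ G ⊗ Y)
    (hy : ψ ≫ γ[G,Y] = y) (hy' : ψ ≫ snd G Y = y') {W : T.left.Opens}
    (h : W ≤ y.left ⁻¹ᵁ U) (h' : W ≤ y'.left ⁻¹ᵁ U) :
    y.left.appLE U W h f = y'.left.appLE U W h' f := by
  subst hy hy'
  have hW : W ≤ ψ.left ⁻¹ᵁ ((γ[G,Y]).left ⁻¹ᵁ U ⊓ (snd G Y).left ⁻¹ᵁ U) := le_inf h h'
  have key := congrArg (ψ.left.appLE _ W hW) (hf _ inf_le_left inf_le_right)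
  rwa [← ConcreteCategory.comp_apply, ← ConcreteCategory.comp_apply, Scheme.Hom.appLE_comp_appLE,
    Scheme.Hom.appLE_comp_appLE] at key

namespace LocalTrivialization

variable {π : Y ⟶ X} (t : LocalTrivialization G π)

/-- The local section of `π : Y ⟶ X` over `base`. -/
abbrev localSection : t.base ⟶ Y := t.sec ≫ t.totalHom

lemma localSection_comp : t.localSection ≫ π = t.baseHom := by
  rw [Category.assoc, ← t.proj_baseHom, ← Category.assoc, t.sec_proj, Category.id_comp]

lemma localSection_comp_left : t.localSection.left ≫ π.left = t.baseHom.left :=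
  congrArg (fun φ => φ.left) t.localSection_comp

lemma proj_comp_left : t.totalHom.left ≫ π.left = t.proj.left ≫ t.baseHom.left :=
  congrArg (fun φ => φ.left) t.proj_baseHom.symm

lemma map_localSection (b : t.base.left) : π.left (t.localSection.left b) = t.baseHom.left b := by
  rw [← Scheme.Hom.comp_apply, t.localSection_comp_left]

lemma preimage_baseHom_le (V : X.left.Opens) :
    t.baseHom.left ⁻¹ᵁ (V ⊓ t.baseHom.left.opensRange) ≤
      t.localSection.left ⁻¹ᵁ π.left ⁻¹ᵁ V := by
  rw [← Scheme.Hom.comp_preimage, t.localSection_comp_left]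
  exact t.baseHom.left.preimage_mono inf_le_left

lemma map_eq_map_of_app_eq {V : X.left.Opens} {g g' : Γ(X.left, V)}
    (h : π.left.app V g = π.left.app V g') :
    X.left.presheaf.map (homOfLE (inf_le_left : V ⊓ t.baseHom.left.opensRange ≤ V)).op g =
      X.left.presheaf.map (homOfLE (inf_le_left : V ⊓ t.baseHom.left.opensRange ≤ V)).op g' := by
  have : IsIso (t.baseHom.left.app (V ⊓ t.baseHom.left.opensRange)) :=
    Scheme.Hom.isIso_app _ _ inf_le_right
  have key : π.left.app V ≫ t.localSection.left.appLE _ _ (t.preimage_baseHom_le V) =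
      X.left.presheaf.map (homOfLE inf_le_left).op ≫
        t.baseHom.left.app (V ⊓ t.baseHom.left.opensRange) :=
    calc _ = (t.localSection.left ≫ π.left).appLE V _ (t.preimage_baseHom_le V) :=
          (Scheme.Hom.comp_appLE _ _ _ _ _).symm
      _ = t.baseHom.left.appLE V _ _ := appLE_congr_hom t.localSection_comp_left _
      _ = _ := by rw [Scheme.Hom.app_eq_appLE t.baseHom.left, Scheme.Hom.map_appLE]
  apply (ConcreteCategory.bijective_of_isIso
    (t.baseHom.left.app (V ⊓ t.baseHom.left.opensRange))).1
  rw [← ConcreteCategory.comp_apply, ← ConcreteCategory.comp_apply, ← key,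
    ConcreteCategory.comp_apply, h, ConcreteCategory.comp_apply]

lemma exists_app_eq_map_of_isInvariantSection {V : X.left.Opens} {f : Γ(Y.left, π.left ⁻¹ᵁ V)}
    (hf : IsInvariantSection G f) :
    ∃ g : Γ(X.left, V ⊓ t.baseHom.left.opensRange), π.left.app _ g =
      Y.left.presheaf.map (homOfLE (π.left.preimage_mono inf_le_left)).op f := by
  set W := V ⊓ t.baseHom.left.opensRange
  have : IsIso (t.baseHom.left.app W) := Scheme.Hom.isIso_app _ _ inf_le_right
  have : IsIso (t.totalHom.left.app (π.left ⁻¹ᵁ W)) :=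
    Scheme.Hom.isIso_app _ _ fun y hy => t.range_totalHom.ge hy.2
  have hW : t.totalHom.left ⁻¹ᵁ π.left ⁻¹ᵁ W ≤ t.proj.left ⁻¹ᵁ t.baseHom.left ⁻¹ᵁ W := by
    rw [← Scheme.Hom.comp_preimage, ← Scheme.Hom.comp_preimage, t.proj_comp_left]
  have app_app : π.left.app W ≫ t.totalHom.left.app (π.left ⁻¹ᵁ W) =
      t.baseHom.left.app W ≫ t.proj.left.appLE _ _ hW := by
    rw [Scheme.Hom.app_eq_appLE t.totalHom.left]
    exact app_comp_appLE_of_comm t.proj_comp_left _ _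
  have map_app : Y.left.presheaf.map (homOfLE (π.left.preimage_mono inf_le_left)).op ≫
      t.totalHom.left.app (π.left ⁻¹ᵁ W) = t.totalHom.left.appLE (π.left ⁻¹ᵁ V) _
        (t.totalHom.left.preimage_mono (π.left.preimage_mono inf_le_left)) := by
    rw [Scheme.Hom.app_eq_appLE t.totalHom.left, Scheme.Hom.map_appLE]
  obtain ⟨g, hg⟩ := (ConcreteCategory.bijective_of_isIso (t.baseHom.left.app W)).2
    (t.localSection.left.appLE (π.left ⁻¹ᵁ V) _ (t.preimage_baseHom_le V) f)
  refine ⟨g, (ConcreteCategory.bijective_of_isIso (t.totalHom.left.app (π.left ⁻¹ᵁ W))).1 ?_⟩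
  rw [← ConcreteCategory.comp_apply, ← ConcreteCategory.comp_apply, app_app, map_app,
    ConcreteCategory.comp_apply, hg, ← ConcreteCategory.comp_apply, Scheme.Hom.appLE_comp_appLE]
  exact (hf.appLE_eq _ t.coord_smul (lift_snd _ _) _ _).symm

lemma exists_lift_total {T : Over S} (y : T ⟶ Y)
    (hy : Set.range (y ≫ π).left ⊆ Set.range t.baseHom.left) :
    ∃ z : T ⟶ t.total, z ≫ t.totalHom = y := by
  have hrange : Set.range y.left ⊆ Set.range t.totalHom.left := by
    rw [t.range_totalHom]
    rintro _ ⟨a, rfl⟩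
    exact hy ⟨a, rfl⟩
  exact ⟨overLift t.totalHom y hrange, overLift_comp _ _ _⟩

lemma exists_translate_total {T : Over S} {z z' : T ⟶ t.total} (h : z ≫ t.proj = z' ≫ t.proj) :
    ∃ ψ : T ⟶ G ⊗ Y, ψ ≫ γ[G,Y] = z ≫ t.totalHom ∧ ψ ≫ snd G Y = z' ≫ t.totalHom := by
  refine ⟨lift (lift (z ≫ t.coord) (z' ≫ t.coordInv) ≫ μ[G]) (z' ≫ t.totalHom), ?_, lift_snd _ _⟩
  have hmul : lift (lift (z ≫ t.coord) (z' ≫ t.coordInv) ≫ μ[G]) (z' ≫ t.totalHom) =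
      lift (lift (z ≫ t.coord) (z' ≫ t.coordInv)) (z' ≫ t.totalHom) ≫ μ[G] ▷ Y := by
    rw [lift_whiskerRight]
  have hassoc : lift (lift (z ≫ t.coord) (z' ≫ t.coordInv)) (z' ≫ t.totalHom) ≫
        (α_ G G Y).hom ≫ G ◁ γ[G,Y] =
      lift (z ≫ t.coord) (z' ≫ lift t.coordInv t.totalHom ≫ γ[G,Y]) := by
    rw [← Category.assoc, lift_lift_associator_hom, lift_whiskerLeft, ← Category.assoc z',
      comp_lift]
  calc _ = lift (z ≫ t.coord) (z' ≫ lift t.coordInv t.totalHom ≫ γ[G,Y]) ≫ γ[G,Y] := by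
        rw [hmul, Category.assoc, ModObj.mul_smul_self, ← hassoc, Category.assoc, Category.assoc]
    _ = z ≫ lift t.coord (t.proj ≫ t.localSection) ≫ γ[G,Y] := by
        rw [t.coordInv_smul, ← Category.assoc z', ← h, Category.assoc, ← comp_lift, Category.assoc]
    _ = z ≫ t.totalHom := by rw [t.coord_smul]

lemma exists_translate {T : Over S} {y y' : T ⟶ Y} (h : y ≫ π = y' ≫ π)
    (hy : Set.range (y ≫ π).left ⊆ Set.range t.baseHom.left) :
    ∃ ψ : T ⟶ G ⊗ Y, ψ ≫ γ[G,Y] = y ∧ ψ ≫ snd G Y = y' := by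
  obtain ⟨z, rfl⟩ := t.exists_lift_total y hy
  obtain ⟨z', rfl⟩ := t.exists_lift_total y' (h ▸ hy)
  refine t.exists_translate_total ?_
  simp only [Category.assoc, ← t.proj_baseHom] at h
  refine Over.OverMorphism.ext ((cancel_mono t.baseHom.left).1 ?_)
  simpa only [Over.comp_left, Category.assoc] using congrArg (fun φ => φ.left) h

end LocalTrivialization

variable {π : Y ⟶ X}

/-- The morphism `(g, y) ↦ (g • y, y)` from `G × Y` to `Y ×_X Y`. -/
abbrev orbitMap (hπ : γ[G,Y] ≫ π = snd G Y ≫ π) : (G ⊗ Y).left ⟶ pullback π.left π.left :=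
  pullback.lift (γ[G,Y]).left (snd G Y).left (congrArg (fun φ => φ.left) hπ)

lemma LocalTrivialization.mem_range_orbitMap (t : LocalTrivialization G π)
    (hπ : γ[G,Y] ≫ π = snd G Y ≫ π) {z : ↥(pullback π.left π.left)}
    (hz : π.left (pullback.fst π.left π.left z) ∈ Set.range t.baseHom.left) :
    z ∈ Set.range (orbitMap hπ) := by
  let O : (pullback π.left π.left).Opens :=
    (pullback.fst π.left π.left ≫ π.left) ⁻¹ᵁ t.baseHom.left.opensRange
  let T : Over S := Over.mk (O.ι ≫ pullback.fst π.left π.left ≫ Y.hom)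
  let y : T ⟶ Y := Over.homMk (O.ι ≫ pullback.fst π.left π.left)
  let y' : T ⟶ Y := Over.homMk (O.ι ≫ pullback.snd π.left π.left) (by
    simp only [T, Over.mk_hom, Category.assoc, ← Over.w π, pullback.condition_assoc])
  have hyy' : y ≫ π = y' ≫ π := by
    ext1
    simp only [y, y', Over.comp_left, Over.homMk_left, Category.assoc, pullback.condition]
  obtain ⟨ψ, hψ, hψ'⟩ := t.exists_translate hyy' (by rintro _ ⟨a, rfl⟩; exact a.2)
  have hfac : ψ.left ≫ orbitMap hπ = O.ι := by
    apply pullback.hom_ext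
    · rw [Category.assoc, pullback.lift_fst]
      exact congrArg (fun φ => φ.left) hψ
    · rw [Category.assoc, pullback.lift_snd]
      exact congrArg (fun φ => φ.left) hψ'
  exact ⟨ψ.left (⟨z, hz⟩ : O), congrArg (fun φ => φ (⟨z, hz⟩ : O)) hfac⟩

lemma isInvariantSection_app (hπ : γ[G,Y] ≫ π = snd G Y ≫ π) {U : X.left.Opens}
    (g : Γ(X.left, U)) : IsInvariantSection G (π.left.app U g) := fun _ h h' =>
  ConcreteCategory.congr_hom (app_comp_appLE_of_comm (congrArg (fun φ => φ.left) hπ :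
    (γ[G,Y]).left ≫ π.left = (snd G Y).left ≫ π.left) h h') g

lemma IsInvariantSet.mem_of_map_eq {Z : Set Y.left} (hZ : IsInvariantSet G Z)
    (hπ : γ[G,Y] ≫ π = snd G Y ≫ π) (horb : Function.Surjective (orbitMap hπ)) {y y' : Y.left}
    (hy : y ∈ Z) (h : π.left y = π.left y') : y' ∈ Z := by
  obtain ⟨a, rfl, rfl⟩ := Scheme.Pullback.exists_preimage_pullback y y' h
  obtain ⟨w, rfl⟩ := horb a
  rw [← Scheme.Hom.comp_apply, pullback.lift_fst] at hy
  rw [← Scheme.Hom.comp_apply, pullback.lift_snd]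
  exact (Set.ext_iff.1 hZ w).1 hy

namespace IsLocallyTrivialTorsor

variable (h : IsLocallyTrivialTorsor G π)
include h

lemma surjective_left : Function.Surjective π.left := by
  intro x
  obtain ⟨t, b, rfl⟩ := h.exists_trivialization x
  exact ⟨t.localSection.left b, t.map_localSection b⟩

lemma surjective_orbitMap : Function.Surjective (orbitMap h.invariant) := by
  intro z
  obtain ⟨t, ht⟩ := h.exists_trivialization (π.left (pullback.fst π.left π.left z))
  exact t.mem_range_orbitMap h.invariant ht

lemma le_iSup_inf_opensRange (U : X.left.Opens) :
    U ≤ ⨆ t : LocalTrivialization G π, U ⊓ t.baseHom.left.opensRange := by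
  intro x hx
  obtain ⟨t, ht⟩ := h.exists_trivialization x
  exact Opens.mem_iSup.2 ⟨t, hx, ht⟩

lemma app_injective (U : X.left.Opens) : Function.Injective (π.left.app U) := fun g g' hgg' =>
  TopCat.Sheaf.eq_of_locally_eq' X.left.sheaf _ U (fun _ => homOfLE inf_le_left)
    (h.le_iSup_inf_opensRange U) g g' fun t => t.map_eq_map_of_app_eq hgg'

lemma exists_app_eq {U : X.left.Opens} {f : Γ(Y.left, π.left ⁻¹ᵁ U)}
    (hf : IsInvariantSection G f) : ∃ g, π.left.app U g = f := by
  let W (t : LocalTrivialization G π) : X.left.Opens := U ⊓ t.baseHom.left.opensRange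
  have app_map {V V' : X.left.Opens} (i : V' ⟶ V) (g : Γ(X.left, V)) :
      π.left.app V' (X.left.presheaf.map i.op g) =
        Y.left.presheaf.map (homOfLE (π.left.preimage_mono i.le)).op (π.left.app V g) :=
    ConcreteCategory.congr_hom (π.left.naturality i.op) g
  choose g hg using fun t : LocalTrivialization G π =>
    t.exists_app_eq_map_of_isInvariantSection hf
  have compatible : TopCat.Presheaf.IsCompatible X.left.presheaf W g := by
    intro t t'
    apply h.app_injective
    rw [app_map, app_map, hg, hg, ← ConcreteCategory.comp_apply, ← ConcreteCategory.comp_apply,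
      ← Functor.map_comp, ← Functor.map_comp]
    rfl
  obtain ⟨s, hs, -⟩ := TopCat.Sheaf.existsUnique_gluing' X.left.sheaf W U
    (fun _ => homOfLE inf_le_left) (h.le_iSup_inf_opensRange U) g compatible
  refine ⟨s, TopCat.Sheaf.eq_of_locally_eq' Y.left.sheaf (fun t => π.left ⁻¹ᵁ W t) (π.left ⁻¹ᵁ U)
    (fun _ => homOfLE (π.left.preimage_mono inf_le_left)) ?_ _ _ fun t => ?_⟩
  · intro y hy
    obtain ⟨t, ht⟩ := Opens.mem_iSup.1 (h.le_iSup_inf_opensRange U hy)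
    exact Opens.mem_iSup.2 ⟨t, ht⟩
  · refine Eq.trans ?_ (hg t)
    rw [← hs t]
    exact (app_map _ s).symm

lemma isClosed_image {Z : Set Y.left} (hZ : IsClosed Z) (hinv : IsInvariantSet G Z) :
    IsClosed (π.left '' Z) := by
  refine isOpen_compl_iff.1 (isOpen_iff_forall_mem_open.2 fun x hx => ?_)
  obtain ⟨t, b, rfl⟩ := h.exists_trivialization x
  refine ⟨t.baseHom.left '' (t.localSection.left ⁻¹' Zᶜ), ?_,
    t.baseHom.left.isOpenEmbedding.isOpenMap _ (hZ.isOpen_compl.preimage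
      t.localSection.left.continuous), Set.mem_image_of_mem _ fun hb => ?_⟩
  · rintro _ ⟨b', hb', rfl⟩ ⟨y, hy, hyb'⟩
    exact hb' (hinv.mem_of_map_eq h.invariant h.surjective_orbitMap hy
      (hyb'.trans (t.map_localSection b').symm))
  · exact hx ⟨_, hb, t.map_localSection b⟩

lemma disjoint_image {Z Z' : Set Y.left} (hinv : IsInvariantSet G Z) (hd : Disjoint Z Z') :
    Disjoint (π.left '' Z) (π.left '' Z') := by
  rw [Set.disjoint_left]
  rintro _ ⟨z, hz, rfl⟩ ⟨z', hz', hzz'⟩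
  exact Set.disjoint_left.1 hd
    (hinv.mem_of_map_eq h.invariant h.surjective_orbitMap hz hzz'.symm) hz'

theorem isGoodGeometricQuotient [IsAffineHom π.left] : IsGoodGeometricQuotient G π where
  invariant := h.invariant
  affine := ‹_›
  surjective := h.surjective_left
  injective_app := h.app_injective
  range_app _ f := ⟨by rintro ⟨g, rfl⟩; exact isInvariantSection_app h.invariant g, h.exists_app_eq⟩
  isClosed_image _ := h.isClosed_image
  disjoint_image _ _ _ hinv _ _ hd := h.disjoint_image hinv hd
  orbits := h.surjective_orbitMap

end IsLocallyTrivialTorsor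

end LocalTrivialization

section SpecMap

variable {R : Type u} [CommRing R] {A B C D : Type u} [CommRing A] [CommRing B] [CommRing C]
  [CommRing D] [Algebra R A] [Algebra R B] [Algebra R C]

/-- The morphism of affine `R`-schemes given by a homomorphism of `R`-algebras. -/
def specMap (f : A →ₐ[R] B) :
    (Spec (.of B)).asOver (Spec (.of R)) ⟶ (Spec (.of A)).asOver (Spec (.of R)) :=
  (algSpec (.of R)).map (CommAlgCat.ofHom f).op

lemma specMap_comp (f : A →ₐ[R] B) (g : B →ₐ[R] C) :
    specMap (g.comp f) = specMap g ≫ specMap f :=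
  (algSpec (.of R)).map_comp (CommAlgCat.ofHom g).op (CommAlgCat.ofHom f).op

variable (R A) in
lemma specMap_id : specMap (AlgHom.id R A) = 𝟙 _ :=
  (algSpec (.of R)).map_id (op (CommAlgCat.of R A))

lemma exists_specMap_eq
    (φ : (Spec (.of B)).asOver (Spec (.of R)) ⟶ (Spec (.of A)).asOver (Spec (.of R))) :
    ∃ f : A →ₐ[R] B, specMap f = φ := by
  have := algSpec.instFull (R := .of R)
  obtain ⟨f, hf⟩ := (algSpec (.of R)).map_surjective (X := op (CommAlgCat.of _ B))
    (Y := op (CommAlgCat.of _ A)) φ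
  exact ⟨f.unop.hom, hf⟩

lemma pullback_lift_specMap (α : A →ₐ[R] B) (β : C →ₐ[R] B)
    (h : Spec.map (CommRingCat.ofHom α.toRingHom) ≫ Spec.map (CommRingCat.ofHom (algebraMap R A)) =
      Spec.map (CommRingCat.ofHom β.toRingHom) ≫ Spec.map (CommRingCat.ofHom (algebraMap R C))) :
    Limits.pullback.lift _ _ h =
      Spec.map (CommRingCat.ofHom
        (Algebra.TensorProduct.lift α β fun _ _ => Commute.all _ _).toRingHom) ≫
        (pullbackSpecIso R A C).inv := by
  apply Limits.pullback.hom_ext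
  · rw [Limits.pullback.lift_fst, Category.assoc, pullbackSpecIso_inv_fst, ← Spec.map_comp]
    congr 1
    ext x
    simp
  · rw [Limits.pullback.lift_snd, Category.assoc, pullbackSpecIso_inv_snd, ← Spec.map_comp]
    congr 1
    ext x
    simp

lemma lift_specMap_left (α : A →ₐ[R] B) (β : C →ₐ[R] B) :
    (lift (specMap α) (specMap β)).left =
      Spec.map (CommRingCat.ofHom
        (Algebra.TensorProduct.lift α β fun _ _ => Commute.all _ _).toRingHom) ≫
        (pullbackSpecIso R A C).inv :=
  pullback_lift_specMap α β ((Over.w (specMap α)).trans (Over.w (specMap β)).symm)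

lemma lift_specMap_includeLeft_includeRight_left :
    (lift (specMap (Algebra.TensorProduct.includeLeft : A →ₐ[R] A ⊗[R] C))
      (specMap (Algebra.TensorProduct.includeRight : C →ₐ[R] A ⊗[R] C))).left =
    (pullbackSpecIso R A C).inv := by
  rw [lift_specMap_left, Algebra.TensorProduct.lift_includeLeft_includeRight]
  exact (congrArg (· ≫ _) (Spec.map_id _)).trans (Category.id_comp _)

lemma lift_specMap_includeLeft_includeRight_surjective :
    Function.Surjective (lift
      (specMap (Algebra.TensorProduct.includeLeft : A →ₐ[R] A ⊗[R] C))
      (specMap (Algebra.TensorProduct.includeRight : C →ₐ[R] A ⊗[R] C))).left := by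
  rw [lift_specMap_includeLeft_includeRight_left]
  exact (pullbackSpecIso R A C).inv.homeomorph.surjective

lemma lift_specMap_smul [Bialgebra R D] (ρ : C →ₐ[R] D ⊗[R] C)
    (h1 : ∀ c, Algebra.TensorProduct.lid R C
      (Algebra.TensorProduct.map (Bialgebra.counitAlgHom R D) (AlgHom.id R C) (ρ c)) = c)
    (h2 : ∀ c, Algebra.TensorProduct.assoc R R R D D C
        (Algebra.TensorProduct.map (Bialgebra.comulAlgHom R D) (AlgHom.id R C) (ρ c)) =
      Algebra.TensorProduct.map (AlgHom.id R D) ρ (ρ c))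
    (α : D →ₐ[R] B) (β : C →ₐ[R] B) :
    lift (specMap α) (specMap β) ≫ (modSpec (.of R) (.of D) (.of C) ρ h1 h2).smul =
      specMap ((Algebra.TensorProduct.lift α β fun _ _ => Commute.all _ _).comp ρ) := by
  ext1
  refine (congrArg (· ≫ (modSpec (.of R) (.of D) (.of C) ρ h1 h2).smul.left)
    (lift_specMap_left α β)).trans ?_
  have inv_hom_cancel {Z Z' : Scheme.{u}} (f : Z ⟶ Spec (.of (D ⊗[R] C)))
      (g : Spec (.of (D ⊗[R] C)) ⟶ Z') :
      (f ≫ (pullbackSpecIso R D C).inv) ≫ (pullbackSpecIso R D C).hom ≫ g = f ≫ g := by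
    rw [Category.assoc, Iso.inv_hom_id_assoc]
  exact (inv_hom_cancel _ _).trans (Spec.map_comp _ _).symm

lemma over_hom_ext_of_affine {W Z : Over (Spec (.of R))} {f g : W ⟶ Z} {I : Type*}
    (O : I → W.left.Opens) (hO : ∀ w, ∃ i, w ∈ O i)
    (h : ∀ (i : I) (B : Type u) [CommRing B] [Algebra R B]
      (a : (Spec (.of B)).asOver (Spec (.of R)) ⟶ W),
      Set.range a.left ⊆ O i → a ≫ f = a ≫ g) : f = g := by
  ext1
  refine Scheme.hom_ext_of_forall _ _ fun w => ?_
  obtain ⟨i, hi⟩ := hO w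
  obtain ⟨_, ⟨V, hV, rfl⟩, hwV, hVO⟩ :=
    W.left.isBasis_affineOpens.exists_subset_of_mem_open hi (O i).isOpen
  have hV : IsAffineOpen V := hV
  obtain ⟨ψ, hψ⟩ := Spec.map_surjective (hV.fromSpec ≫ W.hom)
  let _ : Algebra R Γ(W.left, V) := ψ.hom.toAlgebra
  let a : (Spec (.of Γ(W.left, V))).asOver (Spec (.of R)) ⟶ W := Over.homMk hV.fromSpec hψ.symm
  have ha : a ≫ f = a ≫ g := h i _ a (hV.range_fromSpec.trans_subset hVO)
  have ha' : hV.fromSpec ≫ f.left = hV.fromSpec ≫ g.left := congrArg (fun φ => φ.left) ha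
  refine ⟨V, hwV, ?_⟩
  rw [← hV.isoSpec_hom_fromSpec, Category.assoc, ha', Category.assoc]

end SpecMap

section SubAction

variable {C : Type*} [Category C] [CartesianMonoidalCategory C] {G Y Y' : C} [MonObj G]
  [ModObj G Y]

/-- The restriction of an action along a monomorphism `i : Y' ⟶ Y` through which it factors. -/
@[reducible]
def restrictModObj (i : Y' ⟶ Y) [Mono i] (a : G ⊗ Y' ⟶ Y') (h : a ≫ i = G ◁ i ≫ γ[G,Y]) :
    ModObj G Y' where
  smul := a
  one_smul := by
    change η[G] ▷ Y' ≫ a = (λ_ Y').hom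
    rw [← cancel_mono i, Category.assoc, h, ← whisker_exchange_assoc, ModObj.one_smul_self,
      leftUnitor_naturality]
  mul_smul := by
    change μ[G] ▷ Y' ≫ a = (α_ G G Y').hom ≫ G ◁ a ≫ a
    rw [← cancel_mono i, Category.assoc, Category.assoc, Category.assoc, h,
      ← whisker_exchange_assoc, ModObj.mul_smul_self, ← MonoidalCategory.whiskerLeft_comp_assoc, h]
    simp

end SubAction

/-! ### The action of the torus on `X̂` -/

section SemistableAction

variable {k : Type u} [Field k] {X : Scheme.{u}} [IsIntegral X] [X.Over (Spec (.of k))] {r : ℕ}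
  (L : Fin r → CartierDivisor X) (D : CartierDivisor X)

/-- The algebra homomorphism by which a `B`-point `α` of the torus moves a `B`-point `β` of `X̄`. -/
abbrev smulAlgHom {B : Type u} [CommRing B] [Algebra k B]
    (α : AddMonoidAlgebra k (Pic X) →ₐ[k] B) (β : Cox k L →ₐ[k] B) : Cox k L →ₐ[k] B :=
  (Algebra.TensorProduct.lift α β fun _ _ => Commute.all _ _).comp (coaction k L)

variable {L} in
lemma smulAlgHom_coxOf {B : Type u} [CommRing B] [Algebra k B]
    (α : AddMonoidAlgebra k (Pic X) →ₐ[k] B) (β : Cox k L →ₐ[k] B) (m : Fin r → ℤ)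
    (s : coxPiece k L m) :
    smulAlgHom L α β (coxOf k L m s) =
      α (AddMonoidAlgebra.single (toPic (multiDivisor L m)) 1) * β (coxOf k L m s) := by
  rw [AlgHom.comp_apply, coaction_coxOf, Algebra.TensorProduct.lift_tmul]

lemma lift_specMap_torus_smul {B : Type u} [CommRing B] [Algebra k B]
    (α : AddMonoidAlgebra k (Pic X) →ₐ[k] B) (β : Cox k L →ₐ[k] B) :
    lift (specMap α : _ ⟶ torus k X) (specMap β : _ ⟶ totalSpaceOver k L) ≫
        γ[torus k X, totalSpaceOver k L] = specMap (smulAlgHom L α β) :=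
  lift_specMap_smul _ _ _ α β

variable {L D} in
lemma mem_semistable_iff {p : PrimeSpectrum (Cox k L)} :
    (show totalSpace k L from p) ∈ semistable k L D ↔ ∃ n : ℕ, 0 < n ∧ ∃ m : Fin r → ℤ,
      toPic (multiDivisor L m) = n • toPic D ∧ ∃ s : coxPiece k L m,
        coxOf k L m s ∉ p.asIdeal := by
  change ¬ ((irrelevantIdeal k L D : Set (Cox k L)) ⊆ p.asIdeal) ↔ _
  rw [irrelevantIdeal, SetLike.coe_subset_coe, p.2.radical_le_iff, sectionIdeal, Ideal.span_le,
    Set.not_subset]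
  constructor
  · rintro ⟨_, ⟨n, hn, m, hm, s, rfl⟩, hs⟩
    exact ⟨n, hn, m, hm, s, hs⟩
  · rintro ⟨n, hn, m, hm, s, hs⟩
    exact ⟨_, ⟨n, hn, m, hm, s, rfl⟩, hs⟩

lemma isUnit_single_one {R M : Type*} [Semiring R] [AddGroup M] (g : M) :
    IsUnit (AddMonoidAlgebra.single g (1 : R)) :=
  (Group.isUnit (Multiplicative.ofAdd g)).map (AddMonoidAlgebra.of R M)

variable {L D} in
lemma comap_smulAlgHom_mem_semistable_iff {B : Type u} [CommRing B] [Algebra k B]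
    (α : AddMonoidAlgebra k (Pic X) →ₐ[k] B) (β : Cox k L →ₐ[k] B) (p : PrimeSpectrum B) :
    (show totalSpace k L from PrimeSpectrum.comap (smulAlgHom L α β).toRingHom p) ∈
        semistable k L D ↔
      (show totalSpace k L from PrimeSpectrum.comap β.toRingHom p) ∈ semistable k L D := by
  have mem_iff (m : Fin r → ℤ) (s : coxPiece k L m) :
      smulAlgHom L α β (coxOf k L m s) ∈ p.asIdeal ↔ β (coxOf k L m s) ∈ p.asIdeal := by
    rw [smulAlgHom_coxOf, Ideal.unit_mul_mem_iff_mem _ ((isUnit_single_one _).map α)]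
  simp only [mem_semistable_iff]
  exact exists_congr fun n => and_congr_right fun _ => exists_congr fun m =>
    and_congr_right fun _ => exists_congr fun s => not_congr (mem_iff m s)

lemma smul_mem_semistable (w : (torus k X ⊗ totalSpaceOver k L).left)
    (hw : (snd (torus k X) (totalSpaceOver k L)).left w ∈ semistable k L D) :
    (γ[torus k X, totalSpaceOver k L]).left w ∈ semistable k L D := by
  obtain ⟨p, rfl⟩ := lift_specMap_includeLeft_includeRight_surjective w
  rw [← Scheme.Hom.comp_apply, ← Over.comp_left] at hw ⊢
  rw [lift_snd] at hw
  rw [lift_specMap_torus_smul]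
  exact (comap_smulAlgHom_mem_semistable_iff _ _ p).2 hw

instance : IsOpenImmersion (semistableInclusion k L D).left :=
  inferInstanceAs (IsOpenImmersion (semistable k L D).ι)

instance : Mono (semistableInclusion k L D) := Over.mono_of_mono_left _

variable {L D} in
lemma mem_range_semistableInclusion_iff {y : (totalSpaceOver k L).left} :
    y ∈ Set.range (semistableInclusion k L D).left ↔ y ∈ semistable k L D :=
  ⟨fun ⟨w, hw⟩ => hw ▸ w.2, fun h => ⟨⟨y, h⟩, rfl⟩⟩

lemma range_whiskerLeft_smul_subset :
    Set.range (torus k X ◁ semistableInclusion k L D ≫ γ[torus k X, totalSpaceOver k L]).left ⊆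
      Set.range (semistableInclusion k L D).left := by
  rintro _ ⟨w, rfl⟩
  refine mem_range_semistableInclusion_iff.2 (smul_mem_semistable L D _ ?_)
  exact mem_range_semistableInclusion_iff.1 ⟨(snd (torus k X) (semistableOver k L D)).left w,
    congrArg (fun φ => φ.left w) (whiskerLeft_snd (torus k X) (semistableInclusion k L D)).symm⟩

/-- The restriction of the action `T_X × X̄ → X̄` to `X̂`. -/
def semistableSMul : torus k X ⊗ semistableOver k L D ⟶ semistableOver k L D :=
  overLift (semistableInclusion k L D) _ (range_whiskerLeft_smul_subset L D)

lemma semistableSMul_comp : semistableSMul L D ≫ semistableInclusion k L D =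
    torus k X ◁ semistableInclusion k L D ≫ γ[torus k X, totalSpaceOver k L] :=
  overLift_comp _ _ _

/-- The action of `T_X` on `X̂`. -/
scoped instance semistableAction : ModObj (torus k X) (semistableOver k L D) :=
  restrictModObj (semistableInclusion k L D) (semistableSMul L D) (semistableSMul_comp L D)

lemma isModHom_semistableInclusion : IsModHom (torus k X) (semistableInclusion k L D) :=
  ⟨semistableSMul_comp L D⟩

end SemistableAction

/-! ### Rational functions and local equations -/

section RegularFunctions

variable {X : Scheme.{u}} [IsIntegral X]

variable (X) in
/-- The rational functions that are regular at `x`. -/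
def regularAt (x : X) : Subring X.functionField :=
  (algebraMap (X.presheaf.stalk x) X.functionField).range

/-- The rational function given by a section over a nonempty open subset. -/
def toFunctionField (U : X.Opens) (hU : genericPoint X ∈ U) : Γ(X, U) →+* X.functionField :=
  (X.presheaf.germ U _ hU).hom

lemma genericPoint_mem {U : X.Opens} {x : X} (hx : x ∈ U) : genericPoint X ∈ U :=
  (genericPoint_specializes x).mem_open U.isOpen hx

lemma algebraMap_germ {U : X.Opens} {x : X} (hx : x ∈ U) (hU : genericPoint X ∈ U)
    (a : Γ(X, U)) : algebraMap (X.presheaf.stalk x) X.functionField (X.presheaf.germ U x hx a) =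
      toFunctionField U hU a :=
  have : Nonempty U := ⟨⟨x, hx⟩⟩
  Scheme.algebraMap_germ_eq_germToFunctionField X hx a

lemma toFunctionField_injective (U : X.Opens) (hU : genericPoint X ∈ U) :
    Function.Injective (toFunctionField U hU) :=
  germ_injective_of_isIntegral X _ hU

lemma toFunctionField_res {U V : X.Opens} (h : V ≤ U) (hV : genericPoint X ∈ V) (a : Γ(X, U)) :
    toFunctionField V hV (X.presheaf.map (homOfLE h).op a) = toFunctionField U (h hV) a :=
  X.presheaf.germ_res_apply (homOfLE h) _ hV a

lemma toFunctionField_mem_regularAt {U : X.Opens} {x : X} (hx : x ∈ U)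
    (hU : genericPoint X ∈ U) (a : Γ(X, U)) : toFunctionField U hU a ∈ regularAt X x :=
  ⟨_, algebraMap_germ hx hU a⟩

lemma isUnit_iff_inv_mem_regularAt {x : X} (a : X.presheaf.stalk x) :
    IsUnit a ↔ algebraMap (X.presheaf.stalk x) X.functionField a ≠ 0 ∧
      (algebraMap (X.presheaf.stalk x) X.functionField a)⁻¹ ∈ regularAt X x := by
  have hinj : Function.Injective (algebraMap (X.presheaf.stalk x) X.functionField) :=
    IsFractionRing.injective _ _
  constructor
  · rintro ⟨v, rfl⟩
    have h : algebraMap (X.presheaf.stalk x) X.functionField v *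
        algebraMap (X.presheaf.stalk x) X.functionField (v⁻¹ : (X.presheaf.stalk x)ˣ) = 1 := by
      rw [← map_mul, Units.mul_inv, map_one]
    exact ⟨left_ne_zero_of_mul_eq_one h, _, eq_inv_of_mul_eq_one_right h⟩
  · rintro ⟨h0, b, hb⟩
    refine IsUnit.of_mul_eq_one b (hinj ?_)
    rw [map_mul, hb, mul_inv_cancel₀ h0, map_one]

lemma mem_basicOpen_iff {U : X.Opens} (hη : genericPoint X ∈ U) (a : Γ(X, U)) {x : X}
    (hx : x ∈ U) : x ∈ X.basicOpen a ↔
      toFunctionField U hη a ≠ 0 ∧ (toFunctionField U hη a)⁻¹ ∈ regularAt X x := by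
  rw [Scheme.mem_basicOpen _ _ _ hx, isUnit_iff_inv_mem_regularAt, algebraMap_germ hx hη]

/-- The ideal of denominators of a rational function on an open set. -/
def denominatorIdeal (U : X.Opens) (hU : genericPoint X ∈ U) (f : X.functionField) :
    Ideal Γ(X, U) where
  carrier := {a | ∃ b, toFunctionField U hU b = f * toFunctionField U hU a}
  zero_mem' := ⟨0, by rw [map_zero, mul_zero]⟩
  add_mem' := by
    rintro a a' ⟨b, hb⟩ ⟨b', hb'⟩
    exact ⟨b + b', by rw [map_add, hb, hb', map_add, mul_add]⟩
  smul_mem' := by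
    rintro c a ⟨b, hb⟩
    exact ⟨c * b, by rw [map_mul, hb, smul_eq_mul, map_mul, mul_left_comm]⟩

lemma exists_mem_denominatorIdeal {U : X.Opens} (hU : IsAffineOpen U)
    (hη : genericPoint X ∈ U) {f : X.functionField} {x : X} (hx : x ∈ U)
    (hf : f ∈ regularAt X x) :
    ∃ a ∈ denominatorIdeal U hη f, x ∈ X.basicOpen a := by
  let _ : Algebra Γ(X, U) (X.presheaf.stalk x) :=
    TopCat.Presheaf.algebra_section_stalk X.presheaf ⟨x, hx⟩
  have hloc := hU.isLocalization_stalk ⟨x, hx⟩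
  obtain ⟨a, ha⟩ := hf
  obtain ⟨⟨b, c⟩, hbc⟩ := IsLocalization.surj (hU.primeIdealOf ⟨x, hx⟩).asIdeal.primeCompl a
  refine ⟨c, ⟨b, ?_⟩, (X.mem_basicOpen _ _ hx).2 (IsLocalization.map_units (X.presheaf.stalk x) c)⟩
  rw [← ha, ← algebraMap_germ hx hη, ← algebraMap_germ hx hη, ← map_mul]
  exact congrArg _ hbc.symm

lemma exists_pow_mul_eq_toFunctionField {U : X.Opens} (hU : IsAffineOpen U)
    (hη : genericPoint X ∈ U) (σ : Γ(X, U)) (f : X.functionField)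
    (hf : ∀ x ∈ X.basicOpen σ, f ∈ regularAt X x) :
    ∃ (N : ℕ) (a : Γ(X, U)), toFunctionField U hη a = f * toFunctionField U hη σ ^ N := by
  have hσ : σ ∈ (denominatorIdeal U hη f).radical := by
    rw [Ideal.radical_eq_sInf, Submodule.mem_sInf]
    rintro p ⟨hIp, hp⟩
    by_contra hσp
    let x : X := hU.fromSpec ⟨p, hp⟩
    have hx : x ∈ U := by
      rw [← SetLike.mem_coe, ← hU.range_fromSpec]
      exact ⟨_, rfl⟩
    have hmem (a : Γ(X, U)) : x ∈ X.basicOpen a ↔ a ∉ p :=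
      SetLike.ext_iff.1 (hU.fromSpec_preimage_basicOpen a) ⟨p, hp⟩
    obtain ⟨a, ha, hax⟩ := exists_mem_denominatorIdeal hU hη hx (hf x ((hmem σ).2 hσp))
    exact (hmem a).1 hax (hIp ha)
  obtain ⟨N, b, hb⟩ := hσ
  exact ⟨N, b, by rw [hb, map_pow]⟩

lemma exists_toFunctionField_eq {U : X.Opens} (hU : IsAffineOpen U) (hη : genericPoint X ∈ U)
    (f : X.functionField) (hf : ∀ x ∈ U, f ∈ regularAt X x) :
    ∃ a, toFunctionField U hη a = f := by
  obtain ⟨N, a, ha⟩ := exists_pow_mul_eq_toFunctionField hU hη 1 f fun x hx =>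
    hf x (X.basicOpen_le _ hx)
  exact ⟨a, by rw [ha, map_one, one_pow, mul_one]⟩

end RegularFunctions

section LocalEquations

variable {X : Scheme.{u}} [IsIntegral X]

lemma IsLocalEquation.zsmul {D : CartierDivisor X} {x : X} {g : (X.functionField)ˣ}
    (hg : IsLocalEquation D x g) (n : ℤ) : IsLocalEquation (n • D) x (g ^ n) := by
  unfold IsLocalEquation at *
  rw [map_zsmul, hg, ofMul_zpow, map_zsmul]

lemma IsLocalEquation.nsmul {D : CartierDivisor X} {x : X} {g : (X.functionField)ˣ}
    (hg : IsLocalEquation D x g) (n : ℕ) : IsLocalEquation (n • D) x (g ^ n) := by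
  unfold IsLocalEquation at *
  rw [map_nsmul, hg, ofMul_pow, map_nsmul]

lemma isLocalEquation_principalDivisor (x : X) (g : (X.functionField)ˣ) :
    IsLocalEquation (principalDivisor X (Additive.ofMul g)) x g := rfl

lemma isLocalEquation_multiDivisor {r : ℕ} {L : Fin r → CartierDivisor X} {x : X}
    {g : Fin r → (X.functionField)ˣ} (hg : ∀ i, IsLocalEquation (L i) x (g i)) (m : Fin r → ℤ) :
    IsLocalEquation (multiDivisor L m) x (∏ i, g i ^ m i) := by
  unfold IsLocalEquation
  change germ x (∑ i, m i • L i) = _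
  rw [map_sum, ofMul_prod, map_sum]
  exact Finset.sum_congr rfl fun i _ => (hg i).zsmul (m i)

lemma IsLocalEquation.mul_inv_mem {D : CartierDivisor X} {x : X} {g h : (X.functionField)ˣ}
    (hg : IsLocalEquation D x g) (hh : IsLocalEquation D x h) :
    (h : X.functionField) * (g : X.functionField)⁻¹ ∈ regularAt X x := by
  obtain ⟨v, hv⟩ := hg.exists_eq hh
  refine ⟨v, ?_⟩
  rw [hv]
  field_simp [g.ne_zero]

lemma IsLocalEquation.mul_mem_regularAt {D : CartierDivisor X} {x : X} {g h : (X.functionField)ˣ}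
    (hg : IsLocalEquation D x g) (hh : IsLocalEquation D x h) {f : X.functionField}
    (hf : f * g ∈ regularAt X x) : f * h ∈ regularAt X x := by
  have := (regularAt X x).mul_mem hf (hg.mul_inv_mem hh)
  rwa [show f * g * (h * (g : X.functionField)⁻¹) = f * h by field_simp [g.ne_zero]] at this

lemma IsLocalEquation.of_mul_inv_mem {D : CartierDivisor X} {x : X} {g h : (X.functionField)ˣ}
    (hg : IsLocalEquation D x g) (h₁ : (h : X.functionField) * (g : X.functionField)⁻¹ ∈
      regularAt X x) (h₂ : (g : X.functionField) * (h : X.functionField)⁻¹ ∈ regularAt X x) :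
    IsLocalEquation D x h := by
  obtain ⟨a, ha⟩ := h₁
  have hu : IsUnit a := by
    rw [isUnit_iff_inv_mem_regularAt, ha]
    refine ⟨mul_ne_zero h.ne_zero (inv_ne_zero g.ne_zero), ?_⟩
    rwa [mul_inv, inv_inv, mul_comm]
  obtain ⟨v, rfl⟩ := hu
  have : h = g * Units.map (algebraMap (X.presheaf.stalk x) X.functionField).toMonoidHom v := by
    ext
    change (h : X.functionField) = g * algebraMap (X.presheaf.stalk x) X.functionField v
    rw [ha]
    field_simp [g.ne_zero]
  unfold IsLocalEquation at *
  rw [hg, this, ofMul_mul, map_add]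
  refine (add_eq_left.2 ?_).symm
  exact (QuotientGroup.eq_one_iff _).2 ⟨v, rfl⟩

variable {k : Type u} [Field k] [X.Over (Spec (.of k))]

lemma mul_mem_regularAt_of_mem_H0 {D : CartierDivisor X} {f : X.functionField} (hf : f ∈ H0 k D)
    {x : X} {g : (X.functionField)ˣ} (hg : IsLocalEquation D x g) : f * g ∈ regularAt X x :=
  hf x g hg

lemma mem_H0_of_exists {D : CartierDivisor X} {f : X.functionField}
    (h : ∀ x, ∃ g, IsLocalEquation D x g ∧ f * g ∈ regularAt X x) : f ∈ H0 k D := by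
  intro x g hg
  obtain ⟨h, hh, hf⟩ := h x
  exact hh.mul_mem_regularAt hg hf

lemma pow_mem_H0 {D : CartierDivisor X} {f : X.functionField} (hf : f ∈ H0 k D) (n : ℕ) :
    f ^ n ∈ H0 k (n • D) := by
  induction n with
  | zero => rw [pow_zero, zero_smul]; exact one_mem_H0 k
  | succ n ih => rw [pow_succ, succ_nsmul]; exact mul_mem_H0 k ih hf

lemma IsNonvanishingAt.mul {D E : CartierDivisor X} {f f' : X.functionField} {x : X}
    (h : IsNonvanishingAt D f x) (h' : IsNonvanishingAt E f' x) :
    IsNonvanishingAt (D + E) (f * f') x := by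
  obtain ⟨hf, h⟩ := h
  obtain ⟨hf', h'⟩ := h'
  refine ⟨mul_ne_zero hf hf', ?_⟩
  have := h.add h'
  rwa [← mul_inv, ← Units.mk0_mul] at this

lemma IsNonvanishingAt.pow {D : CartierDivisor X} {f : X.functionField} {x : X}
    (h : IsNonvanishingAt D f x) (n : ℕ) : IsNonvanishingAt (n • D) (f ^ n) x := by
  obtain ⟨hf, h⟩ := h
  refine ⟨pow_ne_zero n hf, ?_⟩
  have := h.nsmul n
  rwa [inv_pow, show Units.mk0 f hf ^ n = Units.mk0 (f ^ n) (pow_ne_zero n hf) from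
    Units.ext rfl] at this

lemma IsNonvanishingAt.mul_inv_mem {D : CartierDivisor X} {f f' : X.functionField} {x : X}
    (h : IsNonvanishingAt D f x) (hf' : f' ∈ H0 k D) : f' * f⁻¹ ∈ regularAt X x := by
  obtain ⟨hf, h⟩ := h
  have := mul_mem_regularAt_of_mem_H0 hf' h
  simpa using this

lemma isNonvanishingAt_iff {D : CartierDivisor X} {f : X.functionField} (hf : f ∈ H0 k D) {x : X}
    {g : (X.functionField)ˣ} (hg : IsLocalEquation D x g) :
    IsNonvanishingAt D f x ↔ f ≠ 0 ∧ (f * g)⁻¹ ∈ regularAt X x := by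
  constructor
  · rintro ⟨h0, h⟩
    refine ⟨h0, ?_⟩
    have := hg.mul_inv_mem h
    rwa [Units.val_inv_eq_inv_val, Units.val_mk0, ← mul_inv] at this
  · rintro ⟨h0, h⟩
    refine ⟨h0, hg.of_mul_inv_mem ?_ ?_⟩
    · rwa [Units.val_inv_eq_inv_val, Units.val_mk0, ← mul_inv]
    · rw [Units.val_inv_eq_inv_val, Units.val_mk0, inv_inv, mul_comm]
      exact mul_mem_regularAt_of_mem_H0 hf hg

lemma IsNonvanishingAt.isNonvanishingAt_iff {D : CartierDivisor X} {f f' : X.functionField}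
    {x : X} (h : IsNonvanishingAt D f x) (hf' : f' ∈ H0 k D) :
    IsNonvanishingAt D f' x ↔ f' ≠ 0 ∧ f * f'⁻¹ ∈ regularAt X x := by
  obtain ⟨hf, h⟩ := h
  rw [CoxQuotient.isNonvanishingAt_iff hf' h, Units.val_inv_eq_inv_val, Units.val_mk0, mul_inv,
    inv_inv, mul_comm]

lemma isNonvanishingAt_mul_iff {D E : CartierDivisor X} {f f' : X.functionField} (hf : f ∈ H0 k D)
    (hf' : f' ∈ H0 k E) {x : X} :
    IsNonvanishingAt (D + E) (f * f') x ↔ IsNonvanishingAt D f x ∧ IsNonvanishingAt E f' x := by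
  refine ⟨fun h => ?_, fun h => h.1.mul h.2⟩
  obtain ⟨d, hd⟩ := exists_isLocalEquation D x
  obtain ⟨e, he⟩ := exists_isLocalEquation E x
  rw [isNonvanishingAt_iff (mul_mem_H0 k hf hf') (hd.add he)] at h
  obtain ⟨h0, h⟩ := h
  have h1 := left_ne_zero_of_mul h0
  have h2 := right_ne_zero_of_mul h0
  have hd0 := d.ne_zero
  have he0 := e.ne_zero
  rw [isNonvanishingAt_iff hf hd, isNonvanishingAt_iff hf' he]
  refine ⟨⟨h1, ?_⟩, h2, ?_⟩
  · have := (regularAt X x).mul_mem h (mul_mem_regularAt_of_mem_H0 hf' he)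
    rwa [show (f * f' * ((d * e : (X.functionField)ˣ) : X.functionField))⁻¹ * (f' * e) =
      (f * d)⁻¹ by rw [Units.val_mul]; field_simp] at this
  · have := (regularAt X x).mul_mem h (mul_mem_regularAt_of_mem_H0 hf hd)
    rwa [show (f * f' * ((d * e : (X.functionField)ˣ) : X.functionField))⁻¹ * (f * d) =
      (f' * e)⁻¹ by rw [Units.val_mul]; field_simp] at this

lemma isNonvanishingAt_pow_iff {D : CartierDivisor X} {f : X.functionField} (hf : f ∈ H0 k D)
    {n : ℕ} (hn : n ≠ 0) {x : X} : IsNonvanishingAt (n • D) (f ^ n) x ↔ IsNonvanishingAt D f x := by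
  refine ⟨fun h => ?_, fun h => h.pow n⟩
  obtain ⟨n, rfl⟩ := Nat.exists_eq_succ_of_ne_zero hn
  rw [Nat.succ_eq_add_one, succ_nsmul, pow_succ, isNonvanishingAt_mul_iff (pow_mem_H0 hf n) hf] at h
  exact h.2

end LocalEquations

section Center

lemma eq_toSpecΓ_comp {X : Scheme.{u}} {R : CommRingCat.{u}} (f : X ⟶ Spec R) :
    f = X.toSpecΓ ≫ Spec.map ((Scheme.ΓSpecIso R).inv ≫ f.appTop) := by
  rw [Spec.map_comp, ← Scheme.toSpecΓ_naturality_assoc, ← SpecMap_ΓSpecIso_hom,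
    ← Spec.map_comp, Iso.inv_hom_id, Spec.map_id, Category.comp_id]

variable {k : Type u} [Field k] {X : Scheme.{u}} [IsIntegral X] [X.Over (Spec (.of k))]

lemma fromSpecStalk_genericPoint_over :
    X.fromSpecStalk (genericPoint X) ≫ X ↘ Spec (.of k) =
      Spec.map (CommRingCat.ofHom (algebraMap k X.functionField)) := by
  rw [eq_toSpecΓ_comp (X ↘ Spec (.of k)), Scheme.fromSpecStalk_toSpecΓ_assoc, ← Spec.map_comp]
  rfl

lemma exists_center [IsProper (X ↘ Spec (.of k))] (B : ValuationSubring X.functionField)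
    (hk : ∀ c : k, algebraMap k X.functionField c ∈ B) :
    ∃ x : X, ∀ f ∈ regularAt X x, f ∈ B := by
  have hcrit : ValuativeCriterion.Existence (X ↘ Spec (.of k)) := by
    have h : IsProper (X ↘ Spec (.of k)) := inferInstance
    rw [IsProper.eq_valuativeCriterion] at h
    exact h.1.1.1.existence
  let j : k →+* B := (algebraMap k X.functionField).codRestrict B hk
  have hsq : X.fromSpecStalk (genericPoint X) ≫ X ↘ Spec (.of k) =
      Spec.map (CommRingCat.ofHom (algebraMap B X.functionField)) ≫
        Spec.map (CommRingCat.ofHom j) := by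
    rw [fromSpecStalk_genericPoint_over, ← Spec.map_comp]
    rfl
  obtain ⟨l, hl, -⟩ := (hcrit { R := B, K := X.functionField, commSq := ⟨hsq⟩, .. }).exists_lift
  dsimp only at hl
  refine ⟨l (IsLocalRing.closedPoint B), ?_⟩
  let φ := Scheme.stalkClosedPointTo (R := .of B) l
  have hφ : Spec.map φ ≫ X.fromSpecStalk _ = l :=
    Scheme.Spec_stalkClosedPointTo_fromSpecStalk (R := .of B) l
  have hη := Scheme.SpecMap_stalkSpecializes_fromSpecStalk
    ((genericPoint_spec X).specializes (Set.mem_univ (l (IsLocalRing.closedPoint (B : Type u)))))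
  have hl' : Spec.map (CommRingCat.ofHom (algebraMap B X.functionField)) ≫ l =
    X.fromSpecStalk (genericPoint X) := hl
  rw [← hφ] at hl'
  have hl := (Category.assoc _ _ _).trans (hl'.trans hη.symm)
  rw [cancel_mono, ← Spec.map_comp] at hl
  have h := Spec.map_injective hl
  rintro _ ⟨a, rfl⟩
  have := congrArg (fun ψ => ψ.hom a) h
  refine Eq.subst (motive := fun z => z ∈ B) this (Subtype.mem _)

end Center

section Extension

variable {k : Type u} [Field k] {X : Scheme.{u}} [IsIntegral X] [X.Over (Spec (.of k))]
  {D E : CartierDivisor X} {s f : X.functionField}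

lemma exists_isAffineOpen_isLocalEquation (D : CartierDivisor X) {W : X.Opens} {x : X}
    (hx : x ∈ W) :
    ∃ V : X.Opens, IsAffineOpen V ∧ x ∈ V ∧ V ≤ W ∧ ∃ g, ∀ y ∈ V, IsLocalEquation D y g := by
  obtain ⟨U, hU, g, hg⟩ := exists_isLocalEquation_nhds D x
  obtain ⟨_, ⟨V, hV, rfl⟩, hxV, hVU⟩ :=
    X.isBasis_affineOpens.exists_subset_of_mem_open (show x ∈ U ⊓ W from ⟨hU, hx⟩) (U ⊓ W).isOpen
  exact ⟨V, hV, hxV, fun y hy => (hVU hy).2, g, fun y hy => hg y (hVU hy).1⟩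

lemma exists_nhds_mul_pow_mem_regularAt (hs : s ∈ H0 k D) (hs0 : s ≠ 0)
    (hf : ∀ x, IsNonvanishingAt D s x → ∃ g, IsLocalEquation E x g ∧ f * g ∈ regularAt X x)
    (x : X) : ∃ V : X.Opens, x ∈ V ∧ ∃ N₀ : ℕ, ∀ N ≥ N₀, ∀ y ∈ V,
      ∃ g, IsLocalEquation (E + N • D) y g ∧ f * s ^ N * g ∈ regularAt X y := by
  obtain ⟨V', -, hxV', -, d, hd⟩ := exists_isAffineOpen_isLocalEquation D (Opens.mem_top x)
  obtain ⟨V, hV, hxV, hVV', e, he⟩ := exists_isAffineOpen_isLocalEquation E hxV'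
  have hη : genericPoint X ∈ V := genericPoint_mem hxV
  obtain ⟨σ, hσ⟩ := exists_toFunctionField_eq hV hη (s * d) fun y hy =>
    mul_mem_regularAt_of_mem_H0 hs (hd y (hVV' hy))
  have hregular (y : X) (hy : y ∈ X.basicOpen σ) : f * e ∈ regularAt X y := by
    have hyV := X.basicOpen_le σ hy
    rw [mem_basicOpen_iff hη σ hyV, hσ] at hy
    obtain ⟨g, hg, hfg⟩ := hf y ((isNonvanishingAt_iff hs (hd y (hVV' hyV))).2 ⟨hs0, hy.2⟩)
    exact hg.mul_mem_regularAt (he y hyV) hfg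
  obtain ⟨N₀, b, hb⟩ := exists_pow_mul_eq_toFunctionField hV hη σ (f * e) hregular
  refine ⟨V, hxV, N₀, fun N hN y hy =>
    ⟨e * d ^ N, (he y hy).add ((hd y (hVV' hy)).nsmul N), ?_⟩⟩
  obtain ⟨M, rfl⟩ := Nat.exists_eq_add_of_le hN
  have hfactor : f * s ^ (N₀ + M) * ((e * d ^ (N₀ + M) : (X.functionField)ˣ) : X.functionField) =
      toFunctionField V hη (b * σ ^ M) := by
    rw [map_mul, hb, map_pow, hσ, Units.val_mul, Units.val_pow_eq_pow_val]
    ring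
  rw [hfactor]
  exact toFunctionField_mem_regularAt hy hη _

lemma exists_mul_pow_mem_H0 [CompactSpace X] (hs : s ∈ H0 k D) (hs0 : s ≠ 0)
    (hf : ∀ x, IsNonvanishingAt D s x → ∃ g, IsLocalEquation E x g ∧ f * g ∈ regularAt X x) :
    ∃ N₀ : ℕ, ∀ N ≥ N₀, f * s ^ N ∈ H0 k (E + N • D) := by
  choose V hxV N₀ hN₀ using exists_nhds_mul_pow_mem_regularAt hs hs0 hf
  obtain ⟨t, ht⟩ := isCompact_univ.elim_finite_subcover (fun x => (V x : Set X))
    (fun x => (V x).isOpen) fun x _ => Set.mem_iUnion.2 ⟨x, hxV x⟩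
  refine ⟨t.sup N₀, fun N hN => mem_H0_of_exists fun y => ?_⟩
  obtain ⟨x, hx, hy⟩ := Set.mem_iUnion₂.1 (ht (Set.mem_univ y))
  exact hN₀ x N ((Finset.le_sup hx).trans hN) y hy

end Extension

section Ample

variable {k : Type u} [Field k] {X : Scheme.{u}} [IsIntegral X] [X.Over (Spec (.of k))]

lemma exists_section_isNonvanishingAt_iff_mem_basicOpen [CompactSpace X] {D : CartierDivisor X}
    {s : X.functionField} (hs : s ∈ H0 k D) {U : X.Opens} (hη : genericPoint X ∈ U)
    (hU : ∀ y, y ∈ U ↔ IsNonvanishingAt D s y) (φ : Γ(X, U)) :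
    ∃ N : ℕ, ∃ t ∈ H0 k ((N + 1) • D),
      ∀ y, y ∈ X.basicOpen φ ↔ IsNonvanishingAt ((N + 1) • D) t y := by
  have hs0 : s ≠ 0 := ((hU _).1 hη).1
  obtain ⟨N, hN⟩ := exists_mul_pow_mem_H0 (E := 0) (f := toFunctionField U hη φ) hs hs0
    fun y hy => ⟨1, isLocalEquation_zero_one y, by
      rw [Units.val_one, mul_one]
      exact toFunctionField_mem_regularAt ((hU y).2 hy) hη φ⟩
  have hφ := hN N le_rfl
  rw [zero_add] at hφ
  refine ⟨N, toFunctionField U hη φ * s ^ N * s, succ_nsmul D N ▸ mul_mem_H0 k hφ hs,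
    fun y => ?_⟩
  rw [succ_nsmul, isNonvanishingAt_mul_iff hφ hs, ← hU]
  have hiff (hy : y ∈ U) : IsNonvanishingAt (N • D) (toFunctionField U hη φ * s ^ N) y ↔
      y ∈ X.basicOpen φ := by
    rw [(((hU y).1 hy).pow N).isNonvanishingAt_iff hφ, mem_basicOpen_iff hη φ hy, mul_ne_zero_iff,
      mul_inv, mul_left_comm, mul_inv_cancel₀ (pow_ne_zero N hs0), mul_one,
      and_iff_left (pow_ne_zero N hs0)]
  exact ⟨fun hy => ⟨(hiff (X.basicOpen_le φ hy)).2 hy, X.basicOpen_le φ hy⟩,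
    fun hy => (hiff hy.2).1 hy.1⟩

lemma IsAmple.exists_section_le {A : CartierDivisor X} (hA : IsAmple k A) {W : X.Opens} {x : X}
    (hx : x ∈ W) : ∃ n : ℕ, 0 < n ∧ ∃ s ∈ H0 k (n • A), ∃ U : X.Opens,
      IsAffineOpen U ∧ x ∈ U ∧ U ≤ W ∧ ∀ y, y ∈ U ↔ IsNonvanishingAt (n • A) s y := by
  have := hA.compact
  obtain ⟨n, hn, s, hs, U, hU, hxU, hUs⟩ := hA.exists_section x
  obtain ⟨φ, hφW, hxφ⟩ := hU.exists_basicOpen_le ⟨x, hx⟩ hxU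
  obtain ⟨N, t, ht, htφ⟩ :=
    exists_section_isNonvanishingAt_iff_mem_basicOpen hs (genericPoint_mem hxU) hUs φ
  simp only [← mul_smul] at ht htφ
  exact ⟨(N + 1) * n, by positivity, t, ht, X.basicOpen φ, hU.basicOpen φ, hxφ, hφW, htφ⟩

lemma mul_mem_H0_of_mem_H0_add_principalDivisor {D : CartierDivisor X} {h : (X.functionField)ˣ}
    {f : X.functionField} (hf : f ∈ H0 k (D + principalDivisor X (Additive.ofMul h))) :
    f * h ∈ H0 k D := by
  intro x g hg
  have := mul_mem_regularAt_of_mem_H0 hf (hg.add (isLocalEquation_principalDivisor x h))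
  rwa [Units.val_mul, mul_comm (g : X.functionField), ← mul_assoc] at this

lemma isNonvanishingAt_add_principalDivisor_iff {D : CartierDivisor X} {h : (X.functionField)ˣ}
    {f : X.functionField} {x : X} :
    IsNonvanishingAt (D + principalDivisor X (Additive.ofMul h)) f x ↔
      IsNonvanishingAt D (f * h) x := by
  have hiff (hf : f ≠ 0) :
      IsLocalEquation (D + principalDivisor X (Additive.ofMul h)) x (Units.mk0 f hf)⁻¹ ↔
        IsLocalEquation D x (Units.mk0 (f * h) (mul_ne_zero hf h.ne_zero))⁻¹ := by
    have e : (Units.mk0 f hf)⁻¹ = (Units.mk0 (f * h) (mul_ne_zero hf h.ne_zero))⁻¹ * h := by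
      rw [Units.mk0_mul, mul_inv, Units.mk0_val, inv_mul_cancel_right]
    rw [e]
    unfold IsLocalEquation
    rw [map_add, ofMul_mul, map_add]
    exact add_left_inj _
  constructor
  · rintro ⟨h0, hl⟩
    exact ⟨mul_ne_zero h0 h.ne_zero, (hiff _).1 hl⟩
  · rintro ⟨h0, hl⟩
    exact ⟨left_ne_zero_of_mul h0, (hiff _).2 hl⟩

lemma IsAmple.of_toPic_eq {D A : CartierDivisor X} (hA : IsAmple k A) (h : toPic D = toPic A) :
    IsAmple k D := by
  obtain ⟨g, hg⟩ := QuotientAddGroup.eq.1 h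
  have hDA : A = D + principalDivisor X g := by
    change principalDivisor X g = _ at hg
    rw [hg, add_neg_cancel_left]
  refine ⟨hA.compact, fun x => ?_⟩
  obtain ⟨n, hn, s, hs, U, hU, hxU, hUs⟩ := hA.exists_section x
  have hnA : n • A = n • D + principalDivisor X (Additive.ofMul (g.toMul ^ n)) := by
    rw [hDA, smul_add, ← map_nsmul]; rfl
  rw [hnA] at hs hUs
  exact ⟨n, hn, _, mul_mem_H0_of_mem_H0_add_principalDivisor hs, U, hU, hxU, fun y =>
    (hUs y).trans isNonvanishingAt_add_principalDivisor_iff⟩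

end Ample

section LaurentRing

variable (k : Type u) [Field k] {X : Scheme.{u}} [IsIntegral X] [X.Over (Spec (.of k))] {r : ℕ}
  (L : Fin r → CartierDivisor X)

/-- The homomorphism from the Cox ring to the Laurent polynomials over the function field that maps
a section `s` of degree `m` to the monomial `s * X ^ m`. -/
def coxToLaurent : Cox k L →ₐ[k] AddMonoidAlgebra X.functionField (Fin r → ℤ) :=
  DirectSum.toAlgebra k (fun m => coxPiece k L m)
    (fun m => (AddMonoidAlgebra.lsingle (R := k) m).comp (coxPiece k L m).subtype)
    rfl
    (fun _ _ => (AddMonoidAlgebra.single_mul_single ..).symm)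

variable {k L}

lemma coxToLaurent_coxOf {m : Fin r → ℤ} (s : coxPiece k L m) :
    coxToLaurent k L (coxOf k L m s) = AddMonoidAlgebra.single m s.1 :=
  DirectSum.toAddMonoid_of
    (fun m => ((AddMonoidAlgebra.lsingle (R := k) m).comp
      (coxPiece k L m).subtype : coxPiece k L m →ₗ[k]
        AddMonoidAlgebra X.functionField (Fin r → ℤ)).toAddMonoidHom) m s

lemma coeff_coxToLaurent (x : Cox k L) (m : Fin r → ℤ) :
    (coxToLaurent k L x).coeff m =
      DirectSum.component k (Fin r → ℤ) (fun m => coxPiece k L m) m x := by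
  induction x using cox_induction with
  | zero => rw [map_zero]; rfl
  | of m' s =>
    refine (congrArg (fun q => q.coeff m) (coxToLaurent_coxOf s)).trans ?_
    by_cases h : m' = m
    · subst h
      refine (Finsupp.single_eq_same ..).trans ?_
      exact congrArg Subtype.val
        (DirectSum.component.lof_self k (M := fun m => coxPiece k L m) m' s).symm
    · refine (Finsupp.single_eq_of_ne (Ne.symm h)).trans ?_
      exact congrArg Subtype.val
        (DirectSum.of_eq_of_ne (β := fun m => coxPiece k L m) m' m s (Ne.symm h)).symm
  | add x y hx hy =>
    rw [map_add]
    exact congrArg₂ (· + ·) hx hy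

lemma coxToLaurent_injective : Function.Injective (coxToLaurent k L) := by
  rw [injective_iff_map_eq_zero]
  intro x hx
  refine DFinsupp.ext fun m => Subtype.ext ?_
  exact (coeff_coxToLaurent x m).symm.trans (by rw [hx]; rfl)

lemma exists_eq_coxOf {y : Cox k L} {m : Fin r → ℤ} {f : X.functionField}
    (hy : coxToLaurent k L y = .single m f) : ∃ s, y = coxOf k L m s := by
  refine ⟨DirectSum.component k (Fin r → ℤ) (fun m => coxPiece k L m) m y,
    coxToLaurent_injective ?_⟩
  rw [coxToLaurent_coxOf, ← coeff_coxToLaurent, hy]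
  exact congrArg _ (Finsupp.single_eq_same ..).symm

end LaurentRing

/-! ### Charts -/

section Charts

variable (k : Type u) [Field k] {X : Scheme.{u}} [IsIntegral X] [X.Over (Spec (.of k))] {r : ℕ}
  (L : Fin r → CartierDivisor X)

/-- A section `s` of a positive multiple of `∑ aᵢLᵢ` with affine nonvanishing locus `U` over which
all the line bundles `𝒪(Lᵢ)` are trivial, with local equations `g i`. -/
structure Chart (a : Fin r → ℤ) where
  n : ℕ
  n_pos : 0 < n
  s : X.functionField
  s_mem : s ∈ coxPiece k L (n • a)
  U : X.Opens
  isAffineOpen_U : IsAffineOpen U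
  genericPoint_mem_U : genericPoint X ∈ U
  mem_U_iff : ∀ y, y ∈ U ↔ IsNonvanishingAt (multiDivisor L (n • a)) s y
  g : Fin r → (X.functionField)ˣ
  isLocalEquation_g : ∀ i, ∀ y ∈ U, IsLocalEquation (L i) y (g i)

variable {k L} {a : Fin r → ℤ}

lemma exists_chart_mem (hA : IsAmple k (multiDivisor L a)) (x : X) :
    ∃ c : Chart k L a, x ∈ c.U := by
  choose W hxW g hg using fun i => exists_isLocalEquation_nhds (L i) x
  obtain ⟨n, hn, s, hs, U, hU, hxU, hUW, hUs⟩ := hA.exists_section_le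
    (W := ⟨⋂ i, (W i : Set X), isOpen_iInter_of_finite fun i => (W i).isOpen⟩)
    (Set.mem_iInter.2 hxW)
  rw [← map_nsmul] at hs hUs
  exact ⟨⟨n, hn, s, hs, U, hU, genericPoint_mem hxU, hUs, g,
    fun i y hy => hg i y (Set.mem_iInter.1 (hUW hy) i)⟩, hxU⟩

namespace Chart

variable (c c' : Chart k L a)

lemma s_ne_zero : c.s ≠ 0 := ((c.mem_U_iff _).1 c.genericPoint_mem_U).1

/-- The element of the Cox ring given by the section of a chart. -/
def coxElem : Cox k L := coxOf k L (c.n • a) ⟨c.s, c.s_mem⟩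

lemma coxToLaurent_coxElem_pow (N : ℕ) :
    coxToLaurent k L c.coxElem ^ N = AddMonoidAlgebra.single (N • c.n • a) (c.s ^ N) := by
  rw [coxElem, coxToLaurent_coxOf, AddMonoidAlgebra.single_pow]

lemma coxToLaurent_coxOf_pow {n : ℕ} (s : coxPiece k L (n • a)) :
    coxToLaurent k L (coxOf k L (n • a) s) ^ c.n =
      coxToLaurent k L c.coxElem ^ n * .single 0 (s ^ c.n * (c.s ^ n)⁻¹) := by
  rw [coxToLaurent_coxOf, c.coxToLaurent_coxElem_pow, AddMonoidAlgebra.single_pow,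
    AddMonoidAlgebra.single_mul_single, add_zero, smul_comm, mul_left_comm,
    mul_inv_cancel₀ (pow_ne_zero n c.s_ne_zero), mul_one]

lemma isNonvanishingAt_pow {y : X} (hy : y ∈ c.U) (n : ℕ) :
    IsNonvanishingAt (c.n • multiDivisor L (n • a)) (c.s ^ n) y := by
  have := ((c.mem_U_iff y).1 hy).pow n
  rwa [← map_nsmul, smul_comm, map_nsmul] at this

lemma pow_mul_inv_mem_regularAt {n : ℕ} {f : X.functionField} (hf : f ∈ coxPiece k L (n • a))
    {y : X} (hy : y ∈ c.U) : f ^ c.n * (c.s ^ n)⁻¹ ∈ regularAt X y :=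
  (c.isNonvanishingAt_pow hy n).mul_inv_mem (pow_mem_H0 hf c.n)

lemma mem_U_iff_of_mem {y : X} (hy : y ∈ c.U) :
    y ∈ c'.U ↔ c.s ^ c'.n * (c'.s ^ c.n)⁻¹ ∈ regularAt X y := by
  rw [c'.mem_U_iff, ← isNonvanishingAt_pow_iff c'.s_mem c.n_pos.ne',
    (c.isNonvanishingAt_pow hy c'.n).isNonvanishingAt_iff (pow_mem_H0 c'.s_mem c.n),
    and_iff_right (pow_ne_zero _ c'.s_ne_zero)]

lemma exists_basicOpen_eq_inf : ∃ e : Γ(X, c.U),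
    toFunctionField c.U c.genericPoint_mem_U e = c'.s ^ c.n * (c.s ^ c'.n)⁻¹ ∧
      X.basicOpen e = c.U ⊓ c'.U := by
  obtain ⟨e, he⟩ := exists_toFunctionField_eq c.isAffineOpen_U c.genericPoint_mem_U _
    fun _ hx => c.pow_mul_inv_mem_regularAt c'.s_mem hx
  refine ⟨e, he, Opens.ext (Set.ext fun y => ?_)⟩
  have he0 : c'.s ^ c.n * (c.s ^ c'.n)⁻¹ ≠ 0 :=
    mul_ne_zero (pow_ne_zero _ c'.s_ne_zero) (inv_ne_zero (pow_ne_zero _ c.s_ne_zero))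
  have hiff (hy : y ∈ c.U) : y ∈ X.basicOpen e ↔ y ∈ c'.U := by
    rw [mem_basicOpen_iff c.genericPoint_mem_U e hy, he, and_iff_right he0, mul_inv, inv_inv,
      mul_comm, c.mem_U_iff_of_mem c' hy]
  exact ⟨fun hy => ⟨X.basicOpen_le e hy, (hiff (X.basicOpen_le e hy)).1 hy⟩,
    fun hy => (hiff hy.1).2 hy.2⟩

/-- The product of the sections of two charts defines a chart over their intersection. -/
def mul : Chart k L a where
  n := c.n + c'.n
  n_pos := Nat.add_pos_left c.n_pos _
  s := c.s * c'.s
  s_mem := add_smul c.n c'.n a ▸ SetLike.GradedMul.mul_mem c.s_mem c'.s_mem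
  U := c.U ⊓ c'.U
  isAffineOpen_U := by
    obtain ⟨e, -, he⟩ := c.exists_basicOpen_eq_inf c'
    rw [← he]
    exact c.isAffineOpen_U.basicOpen e
  genericPoint_mem_U := ⟨c.genericPoint_mem_U, c'.genericPoint_mem_U⟩
  mem_U_iff y := by
    rw [add_smul, map_add, isNonvanishingAt_mul_iff c.s_mem c'.s_mem, ← c.mem_U_iff,
      ← c'.mem_U_iff]
    rfl
  g := c.g
  isLocalEquation_g i y hy := c.isLocalEquation_g i y hy.1

lemma coxElem_mul : (c.mul c').coxElem = c.coxElem * c'.coxElem := by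
  refine coxToLaurent_injective ?_
  simp only [coxElem, map_mul, coxToLaurent_coxOf, AddMonoidAlgebra.single_mul_single,
    ← add_smul]
  rfl

end Chart

lemma exists_valuationSubring_mem_iff {R F : Type*} [CommRing R] [Field F] (f : R →+* F)
    (P : Ideal R) [P.IsPrime] (hf : RingHom.ker f ≤ P) :
    ∃ B : ValuationSubring F, (∀ x, f x ∈ B) ∧ ∀ x, x ∈ P ↔ f x ∈ B.nonunits := by
  let φ : Localization.AtPrime P →+* F := IsLocalization.lift (M := P.primeCompl) (g := f)
    fun s => IsUnit.mk0 _ fun h => s.2 (hf h)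
  have hφ (x : R) : φ (algebraMap R _ x) = f x := IsLocalization.lift_eq _ x
  obtain ⟨B, hB, hlocal⟩ := IsLocalRing.exists_factor_valuationRing φ
  refine ⟨B, fun x => hφ x ▸ hB _, fun x => ?_⟩
  rw [← hφ, ← IsLocalization.AtPrime.to_map_mem_maximal_iff (Localization.AtPrime P) P,
    IsLocalRing.mem_maximalIdeal, mem_nonunits_iff,
    ← isUnit_map_iff (φ.codRestrict B.toSubring hB)]
  exact (ValuationSubring.coe_mem_nonunits_iff (A := B)
    (a := ⟨φ (algebraMap R _ x), hB _⟩)).symm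

/-- By the valuative criterion a valuation ring of the field of Laurent fractions that dominates the
localization of the Cox ring at `P` has a center on `X`, and a chart containing the center works. -/
lemma exists_coxElem_notMem [IsProper (X ↘ Spec (.of k))]
    (hcov : ∀ x : X, ∃ c : Chart k L a, x ∈ c.U) (P : Ideal (Cox k L)) [hP : P.IsPrime]
    {n : ℕ} (hn : 0 < n) {s : coxPiece k L (n • a)} (hs : coxOf k L (n • a) s ∉ P) :
    ∃ c : Chart k L a, c.coxElem ∉ P := by
  let Λ := AddMonoidAlgebra X.functionField (Fin r → ℤ)
  let i : X.functionField →+* FractionRing Λ :=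
    (algebraMap Λ (FractionRing Λ)).comp AddMonoidAlgebra.singleZeroRingHom
  let j : Cox k L →+* FractionRing Λ :=
    (algebraMap Λ (FractionRing Λ)).comp (coxToLaurent k L).toRingHom
  have hj : Function.Injective j :=
    (IsFractionRing.injective Λ (FractionRing Λ)).comp coxToLaurent_injective
  obtain ⟨B, hB, hBP⟩ := exists_valuationSubring_mem_iff j P
    (by rw [(RingHom.injective_iff_ker_eq_bot j).1 hj]; exact bot_le)
  obtain ⟨x, hx⟩ := exists_center (k := k) (B.comap i) fun t => by
    have := hB (algebraMap k (Cox k L) t)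
    change algebraMap Λ (FractionRing Λ) (coxToLaurent k L (algebraMap k (Cox k L) t)) ∈ B at this
    rwa [AlgHom.commutes] at this
  obtain ⟨c, hc⟩ := hcov x
  have hfactor : j (coxOf k L (n • a) s) ^ c.n =
      j c.coxElem ^ n * i (s ^ c.n * (c.s ^ n)⁻¹) := by
    have := congrArg (algebraMap Λ (FractionRing Λ)) (c.coxToLaurent_coxOf_pow s)
    rwa [map_mul, map_pow, map_pow] at this
  refine ⟨c, fun hcP => hs (hP.mem_of_pow_mem c.n ((hBP _).2 ?_))⟩
  have hpow := (hBP _).1 (P.pow_mem_of_mem hcP n hn)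
  rw [ValuationSubring.mem_nonunits_iff, map_pow] at hpow ⊢
  rw [hfactor, map_mul]
  exact mul_lt_one_of_lt_of_le hpow
    ((B.valuation_le_one_iff _).2 (hx _ (c.pow_mul_inv_mem_regularAt s.2 hc)))

end Charts

section CodRestrict

variable {k A B C : Type*} [CommRing k] [CommRing A] [CommRing B] [CommRing C]
  [Algebra k A] [Algebra k B] [Algebra k C]

/-- The factorization of a homomorphism of algebras through an injective one whose range contains
all its values. -/
def codRestrictOfInjective (i : B →ₐ[k] C) (hi : Function.Injective i) (f : A →ₐ[k] C)
    (h : ∀ a, f a ∈ i.range) : A →ₐ[k] B :=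
  (AlgEquiv.ofInjective i hi).symm.toAlgHom.comp (f.codRestrict i.range h)

lemma apply_codRestrictOfInjective (i : B →ₐ[k] C) (hi : Function.Injective i) (f : A →ₐ[k] C)
    (h : ∀ a, f a ∈ i.range) (a : A) : i (codRestrictOfInjective i hi f h a) = f a :=
  congrArg Subtype.val ((AlgEquiv.ofInjective i hi).apply_symm_apply (f.codRestrict i.range h a))

end CodRestrict

/-! ### The trivialization over a chart -/

section ChartRings

variable {k : Type u} [Field k] {X : Scheme.{u}} [IsIntegral X] [X.Over (Spec (.of k))] {r : ℕ}
  {L : Fin r → CartierDivisor X} {a : Fin r → ℤ}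

namespace Chart

variable (c : Chart k L a)

/-- The local equation `∏ gᵢ ^ mᵢ` of `∑ mᵢLᵢ` on a chart. -/
def localEquation (m : Fin r → ℤ) : (X.functionField)ˣ := ∏ i, c.g i ^ m i

lemma localEquation_zero : c.localEquation 0 = 1 := Finset.prod_eq_one fun _ _ => zpow_zero _

lemma localEquation_add (m m' : Fin r → ℤ) :
    c.localEquation (m + m') = c.localEquation m * c.localEquation m' :=
  (Finset.prod_congr rfl fun _ _ => zpow_add _ _ _).trans Finset.prod_mul_distrib

lemma localEquation_neg (m : Fin r → ℤ) : c.localEquation (-m) = (c.localEquation m)⁻¹ := by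
  rw [eq_inv_iff_mul_eq_one, ← localEquation_add, neg_add_cancel, localEquation_zero]

lemma isLocalEquation_localEquation (m : Fin r → ℤ) {y : X} (hy : y ∈ c.U) :
    IsLocalEquation (multiDivisor L m) y (c.localEquation m) :=
  isLocalEquation_multiDivisor (fun i => c.isLocalEquation_g i y hy) m

/-- The ring of functions on the base of a chart. -/
def BaseRing : Type u := Γ(X, c.U)

instance : CommRing c.BaseRing := inferInstanceAs (CommRing Γ(X, c.U))

instance : Algebra k c.BaseRing :=
  ((X.presheaf.map (homOfLE le_top : c.U ⟶ ⊤).op).hom.comp (constants k X)).toAlgebra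

/-- Functions on the base of a chart as rational functions. -/
def baseToField : c.BaseRing →ₐ[k] X.functionField where
  toRingHom := toFunctionField c.U c.genericPoint_mem_U
  commutes' t := toFunctionField_res (U := ⊤) le_top c.genericPoint_mem_U (constants k X t)

lemma baseToField_injective : Function.Injective c.baseToField :=
  toFunctionField_injective c.U c.genericPoint_mem_U

lemma exists_baseToField_eq {f : X.functionField} (hf : ∀ x ∈ c.U, f ∈ regularAt X x) :
    ∃ b, c.baseToField b = f :=
  exists_toFunctionField_eq c.isAffineOpen_U c.genericPoint_mem_U f hf

lemma baseToField_mem_regularAt (b : c.BaseRing) {x : X} (hx : x ∈ c.U) :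
    c.baseToField b ∈ regularAt X x :=
  toFunctionField_mem_regularAt hx c.genericPoint_mem_U b

/-- The ring of functions on the open subset of `X̄` where the section of a chart does not vanish:
the localization of the Cox ring at that section. -/
abbrev TotalRing : Type u := Localization.Away c.coxElem

/-- The localization homomorphism. -/
def toTotal : Cox k L →ₐ[k] c.TotalRing := IsScalarTower.toAlgHom k (Cox k L) c.TotalRing

lemma isUnit_toTotal_coxElem : IsUnit (c.toTotal c.coxElem) :=
  IsLocalization.Away.algebraMap_isUnit c.coxElem

lemma exists_mul_toTotal_eq (x : c.TotalRing) :
    ∃ (y : Cox k L) (N : ℕ), x * c.toTotal c.coxElem ^ N = c.toTotal y := by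
  obtain ⟨⟨y, _, N, rfl⟩, h⟩ := IsLocalization.surj (Submonoid.powers c.coxElem) x
  exact ⟨y, N, (congrArg (x * ·) (map_pow c.toTotal c.coxElem N).symm).trans h⟩

section LiftTotal

variable {B : Type*} [CommRing B] [Algebra k B]

/-- The extension to the localization at the section of a chart of a homomorphism that inverts the
section. -/
def liftTotal (f : Cox k L →ₐ[k] B) (hf : IsUnit (f c.coxElem)) : c.TotalRing →ₐ[k] B :=
  IsLocalization.liftAlgHom (M := Submonoid.powers c.coxElem) (f := f) (by
    rintro ⟨_, n, rfl⟩
    rw [map_pow]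
    exact hf.pow n)

lemma liftTotal_toTotal (f : Cox k L →ₐ[k] B) (hf : IsUnit (f c.coxElem)) (x : Cox k L) :
    c.liftTotal f hf (c.toTotal x) = f x :=
  IsLocalization.lift_eq _ x

lemma liftTotal_comp_toTotal (f : Cox k L →ₐ[k] B) (hf : IsUnit (f c.coxElem)) :
    (c.liftTotal f hf).comp c.toTotal = f :=
  AlgHom.ext (c.liftTotal_toTotal f hf)

lemma totalRing_algHom_ext {f g : c.TotalRing →ₐ[k] B}
    (h : ∀ (m) (s : coxPiece k L m), f (c.toTotal (coxOf k L m s)) =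
      g (c.toTotal (coxOf k L m s))) : f = g := by
  refine IsLocalization.algHom_ext (Submonoid.powers c.coxElem) (AlgHom.ext fun x => ?_)
  change f (c.toTotal x) = g (c.toTotal x)
  induction x using cox_induction with
  | zero => simp only [map_zero]
  | of m s => exact h m s
  | add x y hx hy => rw [map_add, map_add, map_add, hx, hy]

end LiftTotal

/-- The extension of `coxToLaurent` to the localization at the section of a chart. -/
def totalToLaurent : c.TotalRing →ₐ[k] AddMonoidAlgebra X.functionField (Fin r → ℤ) :=
  c.liftTotal (coxToLaurent k L) (by
    refine IsUnit.of_mul_eq_one (AddMonoidAlgebra.single (-(c.n • a)) c.s⁻¹) ?_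
    rw [coxElem, coxToLaurent_coxOf, AddMonoidAlgebra.single_mul_single, add_neg_cancel,
      mul_inv_cancel₀ c.s_ne_zero]
    rfl)

lemma totalToLaurent_toTotal (x : Cox k L) :
    c.totalToLaurent (c.toTotal x) = coxToLaurent k L x :=
  c.liftTotal_toTotal _ _ x

lemma totalToLaurent_coxElem_pow (N : ℕ) :
    c.totalToLaurent (c.toTotal c.coxElem ^ N) = .single (N • c.n • a) (c.s ^ N) := by
  rw [map_pow, totalToLaurent_toTotal, coxToLaurent_coxElem_pow]

lemma totalToLaurent_injective : Function.Injective c.totalToLaurent := by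
  rw [injective_iff_map_eq_zero]
  intro x hx
  obtain ⟨y, N, h⟩ := c.exists_mul_toTotal_eq x
  have hy : y = 0 := coxToLaurent_injective (by
    rw [← totalToLaurent_toTotal, ← h, map_mul, hx, zero_mul, map_zero])
  rw [hy, map_zero] at h
  exact ((c.isUnit_toTotal_coxElem.pow N).mul_left_eq_zero).1 h

lemma exists_mul_pow_eq_toTotal_coxOf {x : c.TotalRing} {m : Fin r → ℤ} {f : X.functionField}
    (hx : c.totalToLaurent x = .single m f) :
    ∃ (N : ℕ) (s : coxPiece k L (m + N • c.n • a)),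
      x * c.toTotal c.coxElem ^ N = c.toTotal (coxOf k L _ s) := by
  obtain ⟨y, N, h⟩ := c.exists_mul_toTotal_eq x
  obtain ⟨s, rfl⟩ := exists_eq_coxOf (y := y) (m := m + N • c.n • a) (f := f * c.s ^ N) (by
    rw [← totalToLaurent_toTotal, ← h, map_mul, hx, totalToLaurent_coxElem_pow,
      AddMonoidAlgebra.single_mul_single])
  exact ⟨N, s, h⟩

section Twist

variable {B : Type u} [CommRing B] [Algebra k B] (α : AddMonoidAlgebra k (Pic X) →ₐ[k] B)
  (β : c.TotalRing →ₐ[k] B)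

/-- The algebra homomorphism by which a `B`-point `α` of the torus moves a `B`-point `β` of the
total space of a chart. -/
def twist : c.TotalRing →ₐ[k] B :=
  c.liftTotal (smulAlgHom L α (β.comp c.toTotal))
    (smulAlgHom_coxOf α _ _ ⟨c.s, c.s_mem⟩ ▸
      ((isUnit_single_one _).map α).mul (c.isUnit_toTotal_coxElem.map β))

lemma twist_comp_toTotal :
    (c.twist α β).comp c.toTotal = smulAlgHom L α (β.comp c.toTotal) :=
  c.liftTotal_comp_toTotal _ _

lemma twist_toTotal_coxOf {m : Fin r → ℤ} (s : coxPiece k L m) :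
    c.twist α β (c.toTotal (coxOf k L m s)) =
      α (.single (toPic (multiDivisor L m)) 1) * β (c.toTotal (coxOf k L m s)) :=
  (c.liftTotal_toTotal _ _ _).trans (smulAlgHom_coxOf ..)

lemma twist_eq_of_totalToLaurent_eq_single {x : c.TotalRing} {m : Fin r → ℤ} {f : X.functionField}
    (hx : c.totalToLaurent x = .single m f) :
    c.twist α β x = α (.single (toPic (multiDivisor L m)) 1) * β x := by
  obtain ⟨N, s, h⟩ := c.exists_mul_pow_eq_toTotal_coxOf hx
  have hcharacter : α (.single (toPic (multiDivisor L (m + N • c.n • a))) 1) =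
      α (.single (toPic (multiDivisor L m)) 1) *
        α (.single (toPic (multiDivisor L (c.n • a))) 1) ^ N := by
    rw [← map_pow, ← map_mul, AddMonoidAlgebra.single_pow, AddMonoidAlgebra.single_mul_single,
      one_pow, one_mul, map_add, map_add, map_nsmul _ N, map_nsmul _ N]
  have hpow : c.twist α β (c.toTotal c.coxElem ^ N) =
      α (.single (toPic (multiDivisor L (c.n • a))) 1) ^ N * β (c.toTotal c.coxElem ^ N) := by
    rw [map_pow, map_pow, ← mul_pow]
    exact congrArg (· ^ N) (c.twist_toTotal_coxOf α β ⟨c.s, c.s_mem⟩)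
  refine ((c.isUnit_toTotal_coxElem.pow N).map (c.twist α β)).mul_right_cancel ?_
  rw [← map_mul, h, twist_toTotal_coxOf, ← h, hcharacter, hpow, map_mul]
  ring

end Twist

lemma exists_mul_pow_mem_coxPiece [CompactSpace X] {m : Fin r → ℤ} {f : X.functionField}
    (hf : ∀ x ∈ c.U, f * c.localEquation m ∈ regularAt X x) :
    ∃ N : ℕ, f * c.s ^ N ∈ coxPiece k L (m + N • c.n • a) := by
  obtain ⟨N, hN⟩ := exists_mul_pow_mem_H0 (E := multiDivisor L m) (f := f) c.s_mem c.s_ne_zero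
    fun x hx => ⟨c.localEquation m,
      c.isLocalEquation_localEquation m ((c.mem_U_iff x).2 hx), hf x ((c.mem_U_iff x).2 hx)⟩
  refine ⟨N, ?_⟩
  rw [coxPiece, map_add, map_nsmul]
  exact hN N le_rfl

lemma single_mem_range_totalToLaurent [CompactSpace X] {m : Fin r → ℤ} {f : X.functionField}
    (hf : ∀ x ∈ c.U, f * c.localEquation m ∈ regularAt X x) :
    AddMonoidAlgebra.single m f ∈ c.totalToLaurent.range := by
  obtain ⟨N, hN⟩ := c.exists_mul_pow_mem_coxPiece hf
  obtain ⟨v, hv⟩ := c.isUnit_toTotal_coxElem.pow N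
  refine ⟨c.toTotal (coxOf k L _ ⟨_, hN⟩) * (v⁻¹ : c.TotalRingˣ), ?_⟩
  refine ((c.isUnit_toTotal_coxElem.pow N).map c.totalToLaurent).mul_right_cancel ?_
  change c.totalToLaurent _ * c.totalToLaurent _ = _ * c.totalToLaurent _
  rw [← map_mul, mul_assoc, ← hv, Units.inv_mul, mul_one, hv, totalToLaurent_toTotal,
    coxToLaurent_coxOf, totalToLaurent_coxElem_pow, AddMonoidAlgebra.single_mul_single]

/-- The inclusion of the functions on the base of a chart as the elements of degree zero. -/
def baseToTotal [CompactSpace X] : c.BaseRing →ₐ[k] c.TotalRing :=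
  codRestrictOfInjective c.totalToLaurent c.totalToLaurent_injective
    (AddMonoidAlgebra.singleZeroAlgHom.comp c.baseToField)
    (fun b => c.single_mem_range_totalToLaurent (m := 0) fun x hx => by
      rw [localEquation_zero, Units.val_one, mul_one]
      exact c.baseToField_mem_regularAt b hx)

lemma totalToLaurent_baseToTotal [CompactSpace X] (b : c.BaseRing) :
    c.totalToLaurent (c.baseToTotal b) = .single 0 (c.baseToField b) :=
  apply_codRestrictOfInjective ..

/-- The evaluation of Laurent polynomials at the local equations of a chart. -/
def eval : AddMonoidAlgebra X.functionField (Fin r → ℤ) →ₐ[k] X.functionField :=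
  (AddMonoidAlgebra.lift X.functionField X.functionField (Fin r → ℤ)
    { toFun := fun m => (c.localEquation m.toAdd : X.functionField)
      map_one' := by rw [toAdd_one, localEquation_zero, Units.val_one]
      map_mul' := fun m m' => by
        rw [toAdd_mul, localEquation_add, Units.val_mul] }).restrictScalars k

lemma eval_single (m : Fin r → ℤ) (f : X.functionField) :
    c.eval (.single m f) = f * c.localEquation m :=
  AddMonoidAlgebra.lift_single ..

lemma eval_coxToLaurent_mem_regularAt (y : Cox k L) {x : X} (hx : x ∈ c.U) :
    c.eval (coxToLaurent k L y) ∈ regularAt X x := by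
  induction y using cox_induction with
  | zero => rw [map_zero, map_zero]; exact zero_mem _
  | of m s =>
    rw [coxToLaurent_coxOf, eval_single]
    exact mul_mem_regularAt_of_mem_H0 s.2 (c.isLocalEquation_localEquation m hx)
  | add y z hy hz => rw [map_add, map_add]; exact add_mem hy hz

lemma inv_eval_coxToLaurent_coxElem_mem_regularAt {x : X} (hx : x ∈ c.U) :
    (c.eval (coxToLaurent k L c.coxElem))⁻¹ ∈ regularAt X x := by
  rw [coxElem, coxToLaurent_coxOf, eval_single]
  exact ((isNonvanishingAt_iff c.s_mem (c.isLocalEquation_localEquation _ hx)).1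
    ((c.mem_U_iff x).1 hx)).2

lemma eval_totalToLaurent_mem_regularAt (y : c.TotalRing) {x : X} (hx : x ∈ c.U) :
    c.eval (c.totalToLaurent y) ∈ regularAt X x := by
  obtain ⟨z, N, h⟩ := c.exists_mul_toTotal_eq y
  have hz := congrArg (fun w => c.eval (c.totalToLaurent w)) h
  have hunit := (c.isUnit_toTotal_coxElem.map c.totalToLaurent).map c.eval
  simp only [map_mul, map_pow, totalToLaurent_toTotal] at hz hunit
  rw [(eq_mul_inv_iff_mul_eq₀ (pow_ne_zero N hunit.ne_zero)).2 hz, ← inv_pow]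
  exact mul_mem (c.eval_coxToLaurent_mem_regularAt z hx)
    (pow_mem (c.inv_eval_coxToLaurent_coxElem_mem_regularAt hx) N)

/-- The restriction of functions to the section of `X̂ → X` over the base of a chart that is defined
by the local equations. -/
def totalToBase : c.TotalRing →ₐ[k] c.BaseRing :=
  codRestrictOfInjective c.baseToField c.baseToField_injective (c.eval.comp c.totalToLaurent)
    fun y => c.exists_baseToField_eq fun _ hx => c.eval_totalToLaurent_mem_regularAt y hx

lemma baseToField_totalToBase (y : c.TotalRing) :
    c.baseToField (c.totalToBase y) = c.eval (c.totalToLaurent y) :=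
  apply_codRestrictOfInjective ..

lemma totalToBase_comp_baseToTotal [CompactSpace X] :
    c.totalToBase.comp c.baseToTotal = .id k c.BaseRing := by
  refine AlgHom.ext fun b => c.baseToField_injective ?_
  rw [AlgHom.comp_apply, baseToField_totalToBase, totalToLaurent_baseToTotal, eval_single,
    localEquation_zero, Units.val_one, mul_one, AlgHom.id_apply]

lemma totalToLaurent_baseToTotal_totalToBase_coxOf [CompactSpace X] {m : Fin r → ℤ}
    (s : coxPiece k L m) :
    c.totalToLaurent (c.baseToTotal (c.totalToBase (c.toTotal (coxOf k L m s)))) =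
      .single 0 (s * c.localEquation m) := by
  rw [totalToLaurent_baseToTotal, baseToField_totalToBase, totalToLaurent_toTotal,
    coxToLaurent_coxOf, eval_single]

/-- The characters of the torus as Laurent monomials, normalized to be `1` at the local equations
of a chart. -/
def characterToLaurent (e : Pic X →+ (Fin r → ℤ)) :
    AddMonoidAlgebra k (Pic X) →ₐ[k] AddMonoidAlgebra X.functionField (Fin r → ℤ) :=
  AddMonoidAlgebra.lift k _ (Pic X)
    { toFun := fun p => .single (e p.toAdd) (c.localEquation (-(e p.toAdd)) : X.functionField)
      map_one' := by
        rw [toAdd_one, map_zero, neg_zero, localEquation_zero, Units.val_one]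
        rfl
      map_mul' := fun p p' => by
        rw [toAdd_mul, map_add, neg_add, localEquation_add, Units.val_mul,
          AddMonoidAlgebra.single_mul_single] }

lemma characterToLaurent_single (e : Pic X →+ (Fin r → ℤ)) (p : Pic X) :
    c.characterToLaurent e (.single p 1) =
      .single (e p) (c.localEquation (-(e p)) : X.functionField) :=
  (AddMonoidAlgebra.lift_single ..).trans (one_smul ..)

variable [CompactSpace X]

/-- The characters of the torus as units on a chart, which give the coordinates of the points of
`X̂` relative to the section of `X̂ → X` defined by the local equations. -/
def characterToTotal (e : Pic X →+ (Fin r → ℤ)) :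
    AddMonoidAlgebra k (Pic X) →ₐ[k] c.TotalRing :=
  codRestrictOfInjective c.totalToLaurent c.totalToLaurent_injective (c.characterToLaurent e) (by
    intro x
    induction x using AddMonoidAlgebra.induction_on with
    | of p =>
      refine Eq.subst (motive := fun q => q ∈ c.totalToLaurent.range)
        (c.characterToLaurent_single e p).symm
        (c.single_mem_range_totalToLaurent fun _ _ => ?_)
      rw [localEquation_neg, Units.inv_mul]
      exact one_mem _
    | add x y hx hy => rw [map_add]; exact add_mem hx hy
    | smul t x hx => rw [map_smul]; exact Subalgebra.smul_mem _ hx t)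

lemma totalToLaurent_characterToTotal (e : Pic X →+ (Fin r → ℤ)) (p : Pic X) :
    c.totalToLaurent (c.characterToTotal e (.single p 1)) =
      .single (e p) (c.localEquation (-(e p)) : X.functionField) :=
  (apply_codRestrictOfInjective ..).trans (c.characterToLaurent_single e p)

lemma twist_comp_baseToTotal {B : Type u} [CommRing B] [Algebra k B]
    (α : AddMonoidAlgebra k (Pic X) →ₐ[k] B) (β : c.TotalRing →ₐ[k] B) :
    (c.twist α β).comp c.baseToTotal = β.comp c.baseToTotal := by
  refine AlgHom.ext fun b => (c.twist_eq_of_totalToLaurent_eq_single α β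
    (c.totalToLaurent_baseToTotal b)).trans ?_
  rw [map_zero, map_zero, ← AddMonoidAlgebra.one_def, map_one, one_mul, AlgHom.comp_apply]

variable {e : Pic X →+ (Fin r → ℤ)} (he : ∀ m, e (toPic (multiDivisor L m)) = m)
include he

lemma twist_characterToTotal_baseToTotal_comp_totalToBase :
    c.twist (c.characterToTotal e) (c.baseToTotal.comp c.totalToBase) = .id k c.TotalRing := by
  refine c.totalRing_algHom_ext fun m s => c.totalToLaurent_injective ?_
  rw [twist_toTotal_coxOf, map_mul, totalToLaurent_characterToTotal, AlgHom.comp_apply,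
    totalToLaurent_baseToTotal_totalToBase_coxOf, AlgHom.id_apply, totalToLaurent_toTotal,
    coxToLaurent_coxOf, AddMonoidAlgebra.single_mul_single, he, add_zero, localEquation_neg,
    mul_comm (s : X.functionField), Units.inv_mul_cancel_left]

lemma twist_characterToTotal_neg_id :
    c.twist (c.characterToTotal (-e)) (.id k c.TotalRing) = c.baseToTotal.comp c.totalToBase := by
  refine c.totalRing_algHom_ext fun m s => c.totalToLaurent_injective ?_
  rw [twist_toTotal_coxOf, map_mul, totalToLaurent_characterToTotal, AlgHom.comp_apply,
    totalToLaurent_baseToTotal_totalToBase_coxOf, AlgHom.id_apply, totalToLaurent_toTotal,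
    coxToLaurent_coxOf, AddMonoidAlgebra.single_mul_single, AddMonoidHom.neg_apply, he,
    neg_add_cancel, neg_neg, mul_comm (s : X.functionField)]

end Chart

end ChartRings

section ChartMaps

variable {k : Type u} [Field k] {X : Scheme.{u}} [IsIntegral X] [X.Over (Spec (.of k))] {r : ℕ}
  {L : Fin r → CartierDivisor X} {a : Fin r → ℤ}

namespace Chart

variable (c c' : Chart k L a)

/-- The base of a chart as a scheme over `k`. -/
abbrev baseOver : Over (Spec (.of k)) := (Spec (.of c.BaseRing)).asOver (Spec (.of k))

/-- The total space of a chart, the open subset of `X̄` where the section of the chart does not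
vanish, as a scheme over `k`. -/
abbrev totalOver : Over (Spec (.of k)) := (Spec (.of c.TotalRing)).asOver (Spec (.of k))

/-- The inclusion of the base of a chart in `X`. -/
def baseInclusion : c.baseOver ⟶ X.asOver (Spec (.of k)) :=
  Over.homMk c.isAffineOpen_U.fromSpec (by
    change c.isAffineOpen_U.fromSpec ≫ X ↘ Spec (.of k) = Spec.map _
    rw [eq_toSpecΓ_comp (X ↘ Spec (.of k)), c.isAffineOpen_U.fromSpec_toSpecΓ_assoc,
      ← Spec.map_comp]
    rfl)

lemma range_baseInclusion : Set.range c.baseInclusion.left = (show Set X from c.U) :=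
  c.isAffineOpen_U.range_fromSpec

/-- The inclusion of the total space of a chart in `X̄`. -/
abbrev totalToSpace : c.totalOver ⟶ totalSpaceOver k L := specMap c.toTotal

instance : IsOpenImmersion c.totalToSpace.left :=
  inferInstanceAs (IsOpenImmersion (Spec.map (CommRingCat.ofHom
    (algebraMap (Cox k L) (Localization.Away c.coxElem)))))

instance : Mono c.totalToSpace := Over.mono_of_mono_left _

lemma range_totalToSpace : Set.range c.totalToSpace.left =
    {p : PrimeSpectrum (Cox k L) | c.coxElem ∉ p.asIdeal} :=
  PrimeSpectrum.localization_away_comap_range (Localization.Away c.coxElem) c.coxElem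

lemma range_totalToSpace_mul : Set.range (c.mul c').totalToSpace.left =
    Set.range c.totalToSpace.left ∩ Set.range c'.totalToSpace.left := by
  rw [range_totalToSpace, range_totalToSpace, range_totalToSpace]
  refine Set.ext fun p => ?_
  change (c.mul c').coxElem ∉ p.asIdeal ↔ c.coxElem ∉ p.asIdeal ∧ c'.coxElem ∉ p.asIdeal
  rw [coxElem_mul, p.2.mul_mem_iff_mem_or_mem, not_or]

section Semistable

variable {D : CartierDivisor X} (ha : toPic (multiDivisor L a) = toPic D)

include ha in
lemma range_totalToSpace_subset :
    Set.range c.totalToSpace.left ⊆ Set.range (semistableInclusion k L D).left := by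
  rw [range_totalToSpace]
  exact fun p hp => mem_range_semistableInclusion_iff.2 (mem_semistable_iff.2
    ⟨c.n, c.n_pos, c.n • a, by rw [map_nsmul, map_nsmul, ha], _, hp⟩)

/-- The inclusion of the total space of a chart in `X̂`. -/
def totalToSemistable : c.totalOver ⟶ semistableOver k L D :=
  overLift (semistableInclusion k L D) c.totalToSpace (c.range_totalToSpace_subset ha)

lemma totalToSemistable_comp :
    c.totalToSemistable ha ≫ semistableInclusion k L D = c.totalToSpace :=
  overLift_comp _ _ _

instance isOpenImmersion_totalToSemistable : IsOpenImmersion (c.totalToSemistable ha).left := by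
  have : IsOpenImmersion ((c.totalToSemistable ha).left ≫ (semistableInclusion k L D).left) := by
    rw [← Over.comp_left, totalToSemistable_comp]
    infer_instance
  exact IsOpenImmersion.of_comp _ (semistableInclusion k L D).left

lemma mem_range_totalToSemistable_iff {y : (semistableOver k L D).left} :
    y ∈ Set.range (c.totalToSemistable ha).left ↔
      (semistableInclusion k L D).left y ∈ Set.range c.totalToSpace.left := by
  rw [← totalToSemistable_comp c ha]
  constructor
  · rintro ⟨z, rfl⟩
    exact ⟨z, rfl⟩
  · rintro ⟨z, hz⟩
    exact ⟨z, (semistableInclusion k L D).left.isOpenEmbedding.injective hz⟩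

lemma lift_totalToSemistable_smul {B : Type u} [CommRing B] [Algebra k B]
    (α : AddMonoidAlgebra k (Pic X) →ₐ[k] B) (β : c.TotalRing →ₐ[k] B) :
    lift (specMap α : _ ⟶ torus k X) (specMap β ≫ c.totalToSemistable ha) ≫
        γ[torus k X, semistableOver k L D] =
      specMap (c.twist α β) ≫ c.totalToSemistable ha := by
  have hsmul : γ[torus k X, semistableOver k L D] ≫ semistableInclusion k L D =
      torus k X ◁ semistableInclusion k L D ≫ γ[torus k X, totalSpaceOver k L] :=
    semistableSMul_comp L D
  rw [← cancel_mono (semistableInclusion k L D), Category.assoc, hsmul, lift_whiskerLeft_assoc,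
    Category.assoc, Category.assoc, totalToSemistable_comp, ← specMap_comp, ← specMap_comp,
    twist_comp_toTotal, lift_specMap_torus_smul]

end Semistable

variable {c c'} in
/-- The restriction of functions to the base of a smaller chart. -/
def resBase (h : c'.U ≤ c.U) : c.BaseRing →ₐ[k] c'.BaseRing where
  toRingHom := (X.presheaf.map (homOfLE h).op).hom
  commutes' t := c'.baseToField_injective
    ((toFunctionField_res h c'.genericPoint_mem_U _).trans
      ((c.baseToField.commutes t).trans (c'.baseToField.commutes t).symm))

variable {c c'} in
lemma baseToField_resBase (h : c'.U ≤ c.U) (b : c.BaseRing) :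
    c'.baseToField (resBase h b) = c.baseToField b :=
  toFunctionField_res h c'.genericPoint_mem_U b

variable {c c'} in
lemma specMap_resBase_comp_baseInclusion (h : c'.U ≤ c.U) :
    specMap (resBase h) ≫ c.baseInclusion = c'.baseInclusion := by
  ext1
  exact c.isAffineOpen_U.map_fromSpec c'.isAffineOpen_U (homOfLE h).op

variable [CompactSpace X]

/-- The quotient morphism on the total space of a chart. -/
def projection : c.totalOver ⟶ X.asOver (Spec (.of k)) := specMap c.baseToTotal ≫ c.baseInclusion

variable {c c'} in
lemma liftTotal_comp_baseToTotal (h : c'.U ≤ c.U) (hu : IsUnit (c'.toTotal c.coxElem)) :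
    (c.liftTotal c'.toTotal hu).comp c.baseToTotal = c'.baseToTotal.comp (resBase h) := by
  have hlaurent : c'.totalToLaurent.comp (c.liftTotal c'.toTotal hu) = c.totalToLaurent :=
    c.totalRing_algHom_ext fun m s => by
      rw [AlgHom.comp_apply, liftTotal_toTotal, totalToLaurent_toTotal, totalToLaurent_toTotal]
  refine AlgHom.ext fun b => c'.totalToLaurent_injective ?_
  rw [AlgHom.comp_apply, ← AlgHom.comp_apply, hlaurent, AlgHom.comp_apply,
    totalToLaurent_baseToTotal, totalToLaurent_baseToTotal, baseToField_resBase]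

variable {c c'} in
lemma comp_projection_eq_of_isUnit {Z : Over (Spec (.of k))} (z : Z ⟶ c.totalOver)
    (z' : Z ⟶ c'.totalOver) (h : c'.U ≤ c.U) (hu : IsUnit (c'.toTotal c.coxElem))
    (hz : z ≫ c.totalToSpace = z' ≫ c'.totalToSpace) : z ≫ c.projection = z' ≫ c'.projection := by
  have hz' : z = z' ≫ specMap (c.liftTotal c'.toTotal hu) := by
    rw [← cancel_mono c.totalToSpace, hz, Category.assoc, ← specMap_comp, liftTotal_comp_toTotal]
  rw [hz', projection, projection, Category.assoc, ← Category.assoc (specMap _) (specMap _),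
    ← specMap_comp, liftTotal_comp_baseToTotal h, specMap_comp, Category.assoc,
    specMap_resBase_comp_baseInclusion]

variable {c c'} in
lemma comp_projection_eq {Z : Over (Spec (.of k))} (z : Z ⟶ c.totalOver) (z' : Z ⟶ c'.totalOver)
    (hz : z ≫ c.totalToSpace = z' ≫ c'.totalToSpace) : z ≫ c.projection = z' ≫ c'.projection := by
  have hrange : Set.range (z ≫ c.totalToSpace).left ⊆
      Set.range (c.mul c').totalToSpace.left := by
    rw [range_totalToSpace_mul]
    exact Set.subset_inter (Set.range_comp_subset_range z.left c.totalToSpace.left)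
      (hz ▸ Set.range_comp_subset_range z'.left c'.totalToSpace.left)
  have hlift := overLift_comp (c.mul c').totalToSpace _ hrange
  have hu : IsUnit ((c.mul c').toTotal (c.coxElem * c'.coxElem)) :=
    c.coxElem_mul c' ▸ (c.mul c').isUnit_toTotal_coxElem
  rw [map_mul, IsUnit.mul_iff] at hu
  rw [comp_projection_eq_of_isUnit z _ inf_le_left hu.1 hlift.symm,
    comp_projection_eq_of_isUnit z' _ inf_le_right hu.2 (hz.symm.trans hlift.symm)]

end Chart

end ChartMaps

section Glueing

open Limits

lemma exists_over_glue {S : Scheme.{u}} {Y X : Over S} {I : Type u} {U : I → Over S}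
    (i : ∀ c, U c ⟶ Y) [∀ c, IsOpenImmersion (i c).left]
    (hcov : ∀ y : Y.left, ∃ c, y ∈ Set.range (i c).left) (f : ∀ c, U c ⟶ X)
    (h : ∀ c d (Z : Over S) (z : Z ⟶ U c) (w : Z ⟶ U d), z ≫ i c = w ≫ i d → z ≫ f c = w ≫ f d) :
    ∃ φ : Y ⟶ X, ∀ c, i c ≫ φ = f c := by
  let 𝒰 : Scheme.OpenCover.{u} Y.left :=
    Scheme.Cover.mkOfCovers I (fun c => (U c).left) (fun c => (i c).left) hcov
  have hf (c d : I) : pullback.fst (i c).left (i d).left ≫ (f c).left =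
      pullback.snd (i c).left (i d).left ≫ (f d).left := by
    have hover : pullback.snd (i c).left (i d).left ≫ (U d).hom =
        pullback.fst (i c).left (i d).left ≫ (U c).hom := by
      rw [← Over.w (i c), ← Over.w (i d), pullback.condition_assoc]
    refine congrArg (fun φ => φ.left) (h c d
      (Over.mk (pullback.fst (i c).left (i d).left ≫ (U c).hom))
      (Over.homMk (pullback.fst _ _)) (Over.homMk (pullback.snd _ _) hover) ?_)
    ext1
    exact pullback.condition
  have hglue := Scheme.Cover.ι_glueMorphisms 𝒰 (fun c => (f c).left) hf
  refine ⟨Over.homMk (Scheme.Cover.glueMorphisms 𝒰 (fun c => (f c).left) hf) ?_, fun c => ?_⟩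
  · refine Scheme.Cover.hom_ext 𝒰 _ _ fun c => ?_
    rw [← Category.assoc, hglue]
    exact (Over.w (f c)).trans (Over.w (i c)).symm
  · ext1
    exact hglue c

end Glueing

/-! ### The quotient -/

section Quotient

variable {k : Type u} [Field k] {X : Scheme.{u}} [IsIntegral X] [X.Over (Spec (.of k))] {r : ℕ}
  {L : Fin r → CartierDivisor X} {a : Fin r → ℤ}

namespace Chart

section Projection

variable [CompactSpace X] (c c' : Chart k L a)

lemma baseToTotal_mul_toTotal_coxElem_pow {b : c.BaseRing}
    (hb : c.baseToField b = c'.s ^ c.n * (c.s ^ c'.n)⁻¹) :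
    c.baseToTotal b * c.toTotal c.coxElem ^ c'.n = c.toTotal c'.coxElem ^ c.n := by
  refine c.totalToLaurent_injective ?_
  rw [map_mul, totalToLaurent_baseToTotal, totalToLaurent_coxElem_pow, ← map_pow,
    totalToLaurent_toTotal, map_pow, coxToLaurent_coxElem_pow,
    AddMonoidAlgebra.single_mul_single, hb, zero_add, smul_comm c'.n,
    inv_mul_cancel_right₀ (pow_ne_zero _ c.s_ne_zero)]

lemma toTotal_coxElem_notMem (z : PrimeSpectrum c.TotalRing)
    (hz : c.isAffineOpen_U.fromSpec (z.comap c.baseToTotal.toRingHom) ∈ c'.U) :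
    c.toTotal c'.coxElem ∉ z.asIdeal := by
  obtain ⟨b, hb, hU⟩ := c.exists_basicOpen_eq_inf c'
  have hbasicOpen : c.isAffineOpen_U.fromSpec (z.comap c.baseToTotal.toRingHom) ∈
      X.basicOpen b := by
    rw [hU]
    exact ⟨c.isAffineOpen_U.range_fromSpec.le ⟨_, rfl⟩, hz⟩
  have hbz : c.baseToTotal b ∉ z.asIdeal :=
    (c.isAffineOpen_U.fromSpec_preimage_basicOpen b).le hbasicOpen
  have hcz : c.toTotal c.coxElem ∉ z.asIdeal := fun h =>
    z.2.ne_top (Ideal.eq_top_of_isUnit_mem _ h c.isUnit_toTotal_coxElem)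
  intro h
  have hpow := Ideal.pow_mem_of_mem z.asIdeal h c.n c.n_pos
  rw [← c.baseToTotal_mul_toTotal_coxElem_pow c' hb] at hpow
  exact (z.2.mem_or_mem hpow).elim hbz fun h => hcz (z.2.mem_of_pow_mem _ h)

lemma totalToSpace_mem_range (z : c.totalOver.left)
    (hz : c.projection.left z ∈ Set.range c'.baseInclusion.left) :
    c.totalToSpace.left z ∈ Set.range c'.totalToSpace.left := by
  rw [range_totalToSpace]
  exact c.toTotal_coxElem_notMem c' z (c'.range_baseInclusion.le hz)

end Projection

variable [CompactSpace X] {D : CartierDivisor X} {ha : toPic (multiDivisor L a) = toPic D}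
  {π : semistableOver k L D ⟶ X.asOver (Spec (.of k))}
  (hπ : ∀ c : Chart k L a, c.totalToSemistable ha ≫ π = c.projection)
  (hY : ∀ y, ∃ c : Chart k L a, y ∈ Set.range (c.totalToSemistable ha).left)
include hπ hY

lemma range_totalToSemistable (c : Chart k L a) :
    Set.range (c.totalToSemistable ha).left = π.left ⁻¹' Set.range c.baseInclusion.left := by
  have hπ_apply (d : Chart k L a) (z : d.totalOver.left) :
      π.left ((d.totalToSemistable ha).left z) = d.projection.left z :=
    congrArg (fun φ => φ.left z) (hπ d)
  refine Set.Subset.antisymm ?_ fun y hy => ?_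
  · rintro _ ⟨z, rfl⟩
    exact ⟨(specMap c.baseToTotal).left z, (hπ_apply c z).symm⟩
  · obtain ⟨d, z, rfl⟩ := hY y
    rw [mem_range_totalToSemistable_iff, ← Scheme.Hom.comp_apply, ← Over.comp_left,
      totalToSemistable_comp]
    exact d.totalToSpace_mem_range c z (hπ_apply d z ▸ hy)

/-- The trivialization of the quotient morphism over the base of a chart by the coordinates relative
to the section defined by the local equations. -/
def localTrivialization {e : Pic X →+ (Fin r → ℤ)}
    (he : ∀ m, e (toPic (multiDivisor L m)) = m) (c : Chart k L a) :
    LocalTrivialization (torus k X) π where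
  base := c.baseOver
  total := c.totalOver
  baseHom := c.baseInclusion
  totalHom := c.totalToSemistable ha
  proj := specMap c.baseToTotal
  sec := specMap c.totalToBase
  coord := specMap (c.characterToTotal e)
  coordInv := specMap (c.characterToTotal (-e))
  isOpenImmersion_baseHom := inferInstanceAs (IsOpenImmersion c.isAffineOpen_U.fromSpec)
  isOpenImmersion_totalHom := inferInstance
  range_totalHom := range_totalToSemistable hπ hY c
  proj_baseHom := (hπ c).symm
  sec_proj := by rw [← specMap_comp, totalToBase_comp_baseToTotal, specMap_id]
  coord_smul := by
    rw [← Category.assoc, ← specMap_comp, lift_totalToSemistable_smul,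
      twist_characterToTotal_baseToTotal_comp_totalToBase c he, specMap_id, Category.id_comp]
  coordInv_smul := by
    have hsmul := c.lift_totalToSemistable_smul ha (c.characterToTotal (-e)) (.id k c.TotalRing)
    rwa [specMap_id, Category.id_comp, twist_characterToTotal_neg_id c he, specMap_comp,
      Category.assoc] at hsmul

lemma smul_comp_eq_snd_comp :
    γ[torus k X, semistableOver k L D] ≫ π = snd (torus k X) (semistableOver k L D) ≫ π := by
  refine over_hom_ext_of_affine (fun c : Chart k L a =>
    (snd (torus k X) (semistableOver k L D)).left ⁻¹ᵁ (c.totalToSemistable ha).left.opensRange)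
    (fun w => hY _) fun c B _ _ x hx => ?_
  obtain ⟨α, hα⟩ := exists_specMap_eq (x ≫ fst _ _)
  have hrange : Set.range (x ≫ snd _ _).left ⊆ Set.range (c.totalToSemistable ha).left := by
    rintro _ ⟨w, rfl⟩
    exact hx ⟨w, rfl⟩
  obtain ⟨β, hβ⟩ := exists_specMap_eq (overLift (c.totalToSemistable ha) _ hrange)
  have hβ' : specMap β ≫ c.totalToSemistable ha = x ≫ snd _ _ := by rw [hβ, overLift_comp]
  have hx : x = lift (specMap α) (specMap β ≫ c.totalToSemistable ha) := by
    rw [hα, hβ', lift_comp_fst_snd]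
  calc x ≫ γ[torus k X, semistableOver k L D] ≫ π
    _ = specMap (c.twist α β) ≫ c.projection := by
      rw [hx, ← Category.assoc, lift_totalToSemistable_smul, Category.assoc, hπ]
    _ = specMap β ≫ c.projection := by
      rw [projection, ← Category.assoc, ← specMap_comp, twist_comp_baseToTotal, specMap_comp,
        Category.assoc]
    _ = x ≫ snd _ _ ≫ π := by rw [← hπ, ← Category.assoc, hβ', Category.assoc]

lemma isAffineHom (hX : ∀ x : X, ∃ c : Chart k L a, x ∈ c.U) : IsAffineHom π.left := by
  refine isAffineHom_of_forall_exists_isAffineOpen _ fun x => ?_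
  obtain ⟨c, hc⟩ := hX x
  refine ⟨c.U, hc, c.isAffineOpen_U, ?_⟩
  have hpreimage : π.left ⁻¹ᵁ (show X.Opens from c.U) =
      (c.totalToSemistable ha).left.opensRange := by
    ext1
    exact (congrArg (π.left ⁻¹' ·) c.range_baseInclusion).symm.trans
      (range_totalToSemistable hπ hY c).symm
  have : IsAffine c.totalOver.left := inferInstanceAs (IsAffine (Spec (.of c.TotalRing)))
  exact hpreimage ▸ isAffineOpen_opensRange (c.totalToSemistable ha).left

end Chart

variable {D : CartierDivisor X} (ha : toPic (multiDivisor L a) = toPic D)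
  {e : Pic X →+ (Fin r → ℤ)} (he : ∀ m, e (toPic (multiDivisor L m)) = m)
include ha he

lemma exists_mem_range_totalToSemistable [IsProper (X ↘ Spec (.of k))]
    (hX : ∀ x : X, ∃ c : Chart k L a, x ∈ c.U) (y : (semistableOver k L D).left) :
    ∃ c : Chart k L a, y ∈ Set.range (c.totalToSemistable ha).left := by
  obtain ⟨n, hn, m, hm, s, hs⟩ := mem_semistable_iff.1
    (mem_range_semistableInclusion_iff.1 ⟨y, rfl⟩ :
      (semistableInclusion k L D).left y ∈ semistable k L D)
  obtain rfl : m = n • a := by rw [← he m, hm, ← ha, map_nsmul, he]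
  obtain ⟨c, hc⟩ := exists_coxElem_notMem hX _ (hP := PrimeSpectrum.isPrime _) hn hs
  refine ⟨c, (c.mem_range_totalToSemistable_iff ha).2 ?_⟩
  rw [Chart.range_totalToSpace]
  exact hc

theorem exists_isLocallyTrivialTorsor [IsProper (X ↘ Spec (.of k))] (hD : IsAmple k D) :
    ∃ π : semistableOver k L D ⟶ X.asOver (Spec (.of k)),
      IsAffineHom π.left ∧ IsLocallyTrivialTorsor (torus k X) π := by
  have := hD.compact
  have hX : ∀ x : X, ∃ c : Chart k L a, x ∈ c.U := exists_chart_mem (hD.of_toPic_eq ha)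
  have hY := exists_mem_range_totalToSemistable ha he hX
  obtain ⟨π, hπ⟩ := exists_over_glue (fun c : Chart k L a => c.totalToSemistable ha) hY
    (fun c => c.projection) fun c d Z z w h => Chart.comp_projection_eq z w (by
      rw [← c.totalToSemistable_comp ha, ← d.totalToSemistable_comp ha, ← Category.assoc, h,
        Category.assoc])
  refine ⟨π, Chart.isAffineHom hπ hY hX, Chart.smul_comp_eq_snd_comp hπ hY, fun x => ?_⟩
  obtain ⟨c, hc⟩ := hX x
  exact ⟨Chart.localTrivialization hπ hY he c, c.range_baseInclusion.symm ▸ hc⟩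

end Quotient

section Basis

variable {X : Scheme.{u}} [IsIntegral X] {r : ℕ}

lemma toPic_multiDivisor (L : Fin r → CartierDivisor X) (m : Fin r → ℤ) :
    toPic (multiDivisor L m) = ∑ i, m i • toPic (L i) := by
  simp [multiDivisor]

lemma equivFun_toPic_multiDivisor (b : Module.Basis (Fin r) ℤ (Pic X))
    {L : Fin r → CartierDivisor X} (hL : ∀ i, toPic (L i) = b i) (m : Fin r → ℤ) :
    b.equivFun (toPic (multiDivisor L m)) = m := by
  simp only [toPic_multiDivisor, hL, ← b.equivFun_symm_apply, LinearEquiv.apply_symm_apply]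

end Basis

end CoxQuotient

end

theorem mainTheorem3_general (k : Type u) [Field k]
    (X : Scheme.{u}) [X.Over (Spec (.of k))] [IsIntegral X] [IsProper (X ↘ Spec (.of k))]
    {r : ℕ} (L : Fin r → CoxQuotient.CartierDivisor X)
    (e : CoxQuotient.Pic X →+ (Fin r → ℤ))
    (he : ∀ m, e (CoxQuotient.toPic (CoxQuotient.multiDivisor L m)) = m)
    (A : CoxQuotient.CartierDivisor X) (hA : CoxQuotient.IsAmple k A)
    (a : Fin r → ℤ) (ha : CoxQuotient.toPic (CoxQuotient.multiDivisor L a) = CoxQuotient.toPic A) :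
    ∃ _ : ModObj (CoxQuotient.torus k X) (CoxQuotient.semistableOver k L A),
      IsModHom (CoxQuotient.torus k X) (CoxQuotient.semistableInclusion k L A) ∧
      ∃ π : CoxQuotient.semistableOver k L A ⟶ X.asOver (Spec (.of k)),
        CoxQuotient.IsGoodGeometricQuotient (CoxQuotient.torus k X) π := by
  obtain ⟨π, _, hπ⟩ := CoxQuotient.exists_isLocallyTrivialTorsor ha he hA
  let action := CoxQuotient.semistableAction (k := k) L A
  exact ⟨action, CoxQuotient.isModHom_semistableInclusion L A, π, hπ.isGoodGeometricQuotient⟩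

theorem mainTheorem3 (k : Type u) [Field k] [IsAlgClosed k]
    (X : Scheme.{u}) [X.Over (Spec (.of k))] [IsIntegral X] [IsProper (X ↘ Spec (.of k))]
    (hPic : CoxQuotient.PicEqCl k X)
    {r : ℕ} (b : Module.Basis (Fin r) ℤ (CoxQuotient.Pic X))
    (L : Fin r → CoxQuotient.CartierDivisor X) (hL : ∀ i, CoxQuotient.toPic (L i) = b i)
    (hfg : Algebra.FiniteType k (CoxQuotient.Cox k L))
    (A : CoxQuotient.CartierDivisor X) (hA : CoxQuotient.IsAmple k A) :
    ∃ _ : ModObj (CoxQuotient.torus k X) (CoxQuotient.semistableOver k L A),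
      IsModHom (CoxQuotient.torus k X) (CoxQuotient.semistableInclusion k L A) ∧
      ∃ π : CoxQuotient.semistableOver k L A ⟶ X.asOver (Spec (.of k)),
        CoxQuotient.IsGoodGeometricQuotient (CoxQuotient.torus k X) π := by
  have hb := CoxQuotient.equivFun_toPic_multiDivisor b hL
  exact mainTheorem3_general k X L b.equivFun.toAddEquiv.toAddMonoidHom hb A hA
    (b.equivFun (CoxQuotient.toPic A)) (b.equivFun.injective (hb _))
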